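/- Conventions: a compact space is a non-empty compact Hausdorff space. A uniform algebra on a compact space $X$ is a closed subalgebra of $C(X)$ (complex-valued continuous functions, with the uniform norm) that contains the constants and separates the points of $X$; it is non-trivial if it is not $C(X)$, and natural on $X$ if each of its characters is the evaluation at a point of $X$. A Jensen measure for a character $\varphi$ on $A$ is a regular Borel probability measure $\mu$ on $X$ such that $\log|\varphi(f)|\le\int_X\log|f|\,d\mu$ for all $f\in A$ (where $\log 0=-\infty$, and the integral may be $-\infty$); it is trivial if it is a point mass. For a compact set $X\subseteq\mathbb C^n$, $R(X)$ is the closure in $C(X)$ of the algebra of restrictions to $X$ of rational functions with no poles on $X$. Let $A$, $B$ be uniform algebras on compact spaces $X$, $Y$. Then $B$ is a generalised Cole extension of $A$, with associated maps $\Pi$ and $T$, if $\Pi:Y\to X$ is a continuous surjection and $T:C(Y)\to C(X)$ is a unital linear map with $\|T\|=1$ such that $T(g\circ\Pi)=g$ for all $g\in C(X)$ and $T(B)=A$. It is implemented by an action of a compact group $G$ on $Y$ if the action is jointly continuous, $G\cdot y=\Pi^{-1}(\{\Pi(y)\})$ for all $y\in Y$, and $T(f)(\Pi(y))=\int_G f(s\cdot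 y)\,d\mu(s)$ for all $f\in B$ and $y\in Y$, where $\mu$ is the normalised Haar measure on $G$. Proposition. Let $K$ be a compact subset of the open unit disc in $\mathbb C$ such that $R(K)$ is non-trivial and no character on $R(K)$ has a non-trivial Jensen measure. Let $X_K=\{(z,w)\in\mathbb C^2: z\in K,\ |z|^2+|w|^2=1\}$, and let $\Pi:X_K\to K$, $\Pi(z,w)=z$. Then: (a) $R(X_K)$ is natural on $X_K$; (b) the circle group $\mathbb T$ acts continuously on $X_K$ by $s\cdot(z,w)=(z,sw)$ for $s\in\mathbb T$ and $(z,w)\in X_K$; (c) there is a linear map $T:C(X_K)\to C(K)$ such that $R(X_K)$ is a generalised Cole extension of $R(K)$ with associated maps $\Pi$ and $T$, and this extension is implemented by the action of $\mathbb T$ in (b). -/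

import Mathlib

open MeasureTheory

namespace UnifAlg

/-- `A` is a uniform algebra on the compact space `X`: a closed subalgebra of `C(X, ℂ)` which
separates the points of `X` (a `Subalgebra` contains the constant functions). -/
structure IsUniformAlgebra {X : Type*} [TopologicalSpace X] [CompactSpace X]
    (A : Subalgebra ℂ C(X, ℂ)) : Prop where
  isClosed : IsClosed (A : Set C(X, ℂ))
  separatesPoints : A.SeparatesPoints

/-- `A` is natural on `X`: every character on `A` is the evaluation at a point of `X`.
(A character on a Banach algebra is a unital algebra homomorphism to `ℂ`; its continuity is
automatic.) -/
def IsNatural {X : Type*} [TopologicalSpace X] (A : Subalgebra ℂ C(X, ℂ)) : Prop :=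
  ∀ φ : A →ₐ[ℂ] ℂ, ∃ x : X, ∀ f : A, φ f = (f : C(X, ℂ)) x

/-- The integral of an extended real valued function, as the integral of the positive part minus
the integral of the negative part. It is only used for functions that are bounded above, on a
probability space, so that the first term is finite and the value lies in `[-∞, ∞)`. -/
noncomputable def eintegral {X : Type*} [MeasurableSpace X] (μ : Measure X) (g : X → EReal) :
    EReal :=
  ((∫⁻ x, (g x).toENNReal ∂μ : ENNReal) : EReal) - ((∫⁻ x, (-g x).toENNReal ∂μ : ENNReal) : EReal)

/-- `μ` is a Jensen measure for the character `φ` on `A`: a regular Borel probability measure on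
`X` such that `log |φ f| ≤ ∫ log |f| dμ` for all `f ∈ A`, where `log 0 = -∞` and the integral may
be `-∞`. -/
structure IsJensenMeasure {X : Type*} [TopologicalSpace X] [MeasurableSpace X] [BorelSpace X]
    (A : Subalgebra ℂ C(X, ℂ)) (φ : A →ₐ[ℂ] ℂ) (μ : Measure X) : Prop where
  isProbabilityMeasure : IsProbabilityMeasure μ
  regular : μ.Regular
  log_le : ∀ f : A, ENNReal.log ‖φ f‖ₑ ≤ eintegral μ (fun x => ENNReal.log ‖(f : C(X, ℂ)) x‖ₑ)

/-- `A` admits no non-trivial Jensen measures: for every character on `A`, each of its Jensen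
measures is a point mass. -/
def NoNontrivialJensenMeasures {X : Type*} [TopologicalSpace X] [MeasurableSpace X] [BorelSpace X]
    (A : Subalgebra ℂ C(X, ℂ)) : Prop :=
  ∀ (φ : A →ₐ[ℂ] ℂ) (μ : Measure X), IsJensenMeasure A φ μ → ∃ x : X, μ = Measure.dirac x

/-- `B` (on `Y`) is a generalised Cole extension of `A` (on `X`), with associated maps
`p : Y → X` and `T : C(Y) → C(X)`. -/
structure IsGenColeExtension {X Y : Type*} [TopologicalSpace X] [CompactSpace X]
    [TopologicalSpace Y] [CompactSpace Y] (A : Subalgebra ℂ C(X, ℂ)) (B : Subalgebra ℂ C(Y, ℂ))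
    (p : C(Y, X)) (T : C(Y, ℂ) →L[ℂ] C(X, ℂ)) : Prop where
  isUniformAlgebra_base : IsUniformAlgebra A
  isUniformAlgebra_ext : IsUniformAlgebra B
  surjective : Function.Surjective p
  map_one : T 1 = 1
  norm_eq_one : ‖T‖ = 1
  map_comp : ∀ g : C(X, ℂ), T (g.comp p) = g
  image_eq : T '' (B : Set C(Y, ℂ)) = (A : Set C(X, ℂ))

/-- The integral of `f` over the compact group `G` with respect to the normalised Haar measure,
i.e. the Haar measure on the Borel sets of `G` which gives `G` the mass `1`. -/
noncomputable def haarIntegral (G : Type*) [Group G] [TopologicalSpace G] [IsTopologicalGroup G]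
    [CompactSpace G] (f : G → ℂ) : ℂ :=
  letI : MeasurableSpace G := borel G
  haveI : BorelSpace G := ⟨rfl⟩
  ∫ s : G, f s ∂(Measure.haarMeasure (⊤ : TopologicalSpace.PositiveCompacts G))

/-- The generalised Cole extension `B` of `A` with associated maps `p` and `T` is implemented by
the (given) action of the compact group `G` on `Y`: the action is jointly continuous, its orbits
are the fibres of `p`, and on `B` the map `T` is averaging over the orbits with respect to the
normalised Haar measure of `G`. -/
structure IsImplementedBy (G : Type*) [Group G] [TopologicalSpace G] [IsTopologicalGroup G]
    [CompactSpace G] [T2Space G]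
    {X Y : Type*} [TopologicalSpace X] [CompactSpace X]
    [TopologicalSpace Y] [CompactSpace Y] [MulAction G Y]
    (A : Subalgebra ℂ C(X, ℂ)) (B : Subalgebra ℂ C(Y, ℂ))
    (p : C(Y, X)) (T : C(Y, ℂ) →L[ℂ] C(X, ℂ)) : Prop where
  isGenColeExtension : IsGenColeExtension A B p T
  continuous_action : ContinuousSMul G Y
  orbit_eq : ∀ y : Y, MulAction.orbit G y = p ⁻¹' {p y}
  map_eq_integral : ∀ f ∈ B, ∀ y : Y,
    T f (p y) = haarIntegral G (fun s => f (s • y))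

/-- The continuous functions on `X ⊆ ℂⁿ` which are the restrictions of rational functions with no
poles on `X`, that is, of quotients of polynomials whose denominator has no zero on `X`. -/
def rationalFunctions {n : ℕ} (X : Set (Fin n → ℂ)) : Subalgebra ℂ C(X, ℂ) where
  carrier := {f | ∃ a b : MvPolynomial (Fin n) ℂ, ∀ x : X,
    MvPolynomial.eval x.1 b ≠ 0 ∧ f x = MvPolynomial.eval x.1 a / MvPolynomial.eval x.1 b}
  mul_mem' := by
    rintro f g ⟨a, b, h⟩ ⟨c, d, h'⟩
    refine ⟨a * c, b * d, fun x => ⟨?_, ?_⟩⟩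
    · simpa using ⟨(h x).1, (h' x).1⟩
    · simp [(h x).2, (h' x).2, mul_div_mul_comm]
  add_mem' := by
    rintro f g ⟨a, b, h⟩ ⟨c, d, h'⟩
    refine ⟨a * d + b * c, b * d, fun x => ⟨?_, ?_⟩⟩
    · simpa using ⟨(h x).1, (h' x).1⟩
    · simp [(h x).2, (h' x).2, div_add_div _ _ (h x).1 (h' x).1]
  algebraMap_mem' := fun r => ⟨MvPolynomial.C r, 1, fun x => by simp⟩

/-- `R(X)` for a compact set `X ⊆ ℂⁿ`: the uniform closure in `C(X)` of the algebra of rational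
functions with no poles on `X`. -/
noncomputable def R {n : ℕ} (X : Set (Fin n → ℂ)) [CompactSpace X] : Subalgebra ℂ C(X, ℂ) :=
  (rationalFunctions X).topologicalClosure

/-- The one-variable version of `rationalFunctions`, for `K ⊆ ℂ`. -/
def planeRationalFunctions (K : Set ℂ) : Subalgebra ℂ C(K, ℂ) where
  carrier := {f | ∃ a b : Polynomial ℂ, ∀ z : K,
    b.eval z.1 ≠ 0 ∧ f z = a.eval z.1 / b.eval z.1}
  mul_mem' := by
    rintro f g ⟨a, b, h⟩ ⟨c, d, h'⟩
    refine ⟨a * c, b * d, fun x => ⟨?_, ?_⟩⟩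
    · simpa using ⟨(h x).1, (h' x).1⟩
    · simp [(h x).2, (h' x).2, mul_div_mul_comm]
  add_mem' := by
    rintro f g ⟨a, b, h⟩ ⟨c, d, h'⟩
    refine ⟨a * d + b * c, b * d, fun x => ⟨?_, ?_⟩⟩
    · simpa using ⟨(h x).1, (h' x).1⟩
    · simp [(h x).2, (h' x).2, div_add_div _ _ (h x).1 (h' x).1]
  algebraMap_mem' := fun r => ⟨Polynomial.C r, 1, fun x => by simp⟩

/-- `R(K)` for a compact set `K ⊆ ℂ`. -/
noncomputable def planeR (K : Set ℂ) [CompactSpace K] : Subalgebra ℂ C(K, ℂ) :=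
  (planeRationalFunctions K).topologicalClosure

/-- `X_K = {(z, w) ∈ ℂ² : z ∈ K, |z|² + |w|² = 1}`. -/
def XK (K : Set ℂ) : Set (Fin 2 → ℂ) :=
  {v | v 0 ∈ K ∧ ‖v 0‖ ^ 2 + ‖v 1‖ ^ 2 = 1}

instance XK.compactSpace (K : Set ℂ) [hK : CompactSpace K] : CompactSpace (XK K) := by
  rw [← isCompact_iff_compactSpace] at hK ⊢
  refine Metric.isCompact_of_isClosed_isBounded ?_ ?_
  · exact (hK.isClosed.preimage (continuous_apply 0)).inter
      (isClosed_eq (by fun_prop) continuous_const)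
  · refine isBounded_iff_forall_norm_le.2 ⟨1, fun v hv => ?_⟩
    obtain ⟨-, h⟩ := hv
    refine (pi_norm_le_iff_of_nonneg zero_le_one).2 fun i => ?_
    fin_cases i
    · show ‖v 0‖ ≤ 1
      nlinarith [norm_nonneg (v 0), sq_nonneg ‖v 1‖]
    · show ‖v 1‖ ≤ 1
      nlinarith [norm_nonneg (v 1), sq_nonneg ‖v 0‖]

/-- The coordinate projection `X_K → K`, `(z, w) ↦ z`. -/
def XK.proj (K : Set ℂ) : C(XK K, K) where
  toFun v := ⟨v.1 0, v.2.1⟩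
  continuous_toFun :=
    ((continuous_apply 0).comp continuous_subtype_val).subtype_mk _

end UnifAlg

/-! Naturality. Let φ be a character of R(X_K). Consider the u in C(K, ℝ) for which some f with φ f
= 1 satisfies log |f| ≤ n(u ∘ Π - ε) for some n ≥ 1, ε > 0. They form an open convex cone, and 0 is
not in it because φ is contractive. Hahn-Banach and Riesz turn this into a probability measure μ on
K with log |φ f| ≤ ∫ u dμ whenever φ f ≠ 0 and log |f| ≤ u ∘ Π. On pullbacks of R(K) this makes μ a
Jensen measure, so μ is a point mass at some x by hypothesis, and log |φ f| ≤ u(x) for every f in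
R(X_K) with φ f ≠ 0 that is dominated in this way. Applied to z - x this gives φ(z) = x. The moduli
of w and 1/w on X_K depend only on z, so applying it to both gives |φ(w)|² = 1 - |x|². Hence (φ(z),
φ(w)) is a point of X_K, and φ is evaluation there, first on rational functions and then on R(X_K)
by density (`isNatural_R_XK`).

The extension. T averages over the circles |w|² = 1 - |z|². It inverts composition with Π, so only
T(R(X_K)) ⊆ R(K) needs work. For rational f the radius is not holomorphic in z, but by Cauchy's
theorem on an annulus it may be frozen locally without changing the average. The average is
therefore holomorphic near K (`differentiableAt_circleAverage_of_radius`), and a weak Runge theorem,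
derived from the Cauchy-Pompeiu formula, puts it in R(K) (`mem_planeR_of_differentiableOn`). -/

namespace UnifAlg

open Filter Topology

/-! ### Jensen measures by separation of a convex cone -/

section JensenMeasures

variable {X Y : Type*} [TopologicalSpace X] [TopologicalSpace Y]

/-- The real functions `u` on `X` such that `n (u ∘ p - ε)` dominates `log |f|` for some `f` with
`φ f = 1`, some `n ≥ 1` and some `ε > 0`. -/
def logCone {B : Subalgebra ℂ C(Y, ℂ)} (φ : B →ₐ[ℂ] ℂ) (p : C(Y, X)) : Set C(X, ℝ) :=
  {u | ∃ ε : ℝ, 0 < ε ∧ ∃ n : ℕ, 0 < n ∧ ∃ f : B, φ f = 1 ∧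
    ∀ y, ‖(f : C(Y, ℂ)) y‖ ≤ Real.exp (n * (u (p y) - ε))}

variable {B : Subalgebra ℂ C(Y, ℂ)} {φ : B →ₐ[ℂ] ℂ} {p : C(Y, X)}

lemma add_mem_logCone {u v : C(X, ℝ)} (hu : u ∈ logCone φ p) (hv : v ∈ logCone φ p) :
    u + v ∈ logCone φ p := by
  obtain ⟨ε, hε, n, hn, f, hf, hfu⟩ := hu
  obtain ⟨δ, hδ, m, hm, g, hg, hgv⟩ := hv
  -- The powers bring both bounds to the common factor n * m in the exponent.
  refine ⟨ε + δ, by positivity, n * m, by positivity, f ^ m * g ^ n, by simp [hf, hg],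
    fun y => ?_⟩
  calc ‖((f ^ m * g ^ n : B) : C(Y, ℂ)) y‖
      = ‖(f : C(Y, ℂ)) y‖ ^ m * ‖(g : C(Y, ℂ)) y‖ ^ n := by simp
    _ ≤ Real.exp (n * (u (p y) - ε)) ^ m * Real.exp (m * (v (p y) - δ)) ^ n := by
        gcongr
        · exact hfu y
        · exact hgv y
    _ = _ := by
        rw [← Real.exp_nat_mul, ← Real.exp_nat_mul, ← Real.exp_add]
        congr 1
        push_cast [ContinuousMap.add_apply]
        ring

lemma nat_div_smul_mem_logCone {u : C(X, ℝ)} (hu : u ∈ logCone φ p) {k l : ℕ} (hk : 0 < k)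
    (hl : 0 < l) : ((k : ℝ) / l) • u ∈ logCone φ p := by
  obtain ⟨ε, hε, n, hn, f, hf, hfu⟩ := hu
  refine ⟨(k : ℝ) / l * ε, by positivity, n * l, by positivity, f ^ k, by simp [hf],
    fun y => ?_⟩
  calc ‖((f ^ k : B) : C(Y, ℂ)) y‖ = ‖(f : C(Y, ℂ)) y‖ ^ k := by simp
    _ ≤ Real.exp (n * (u (p y) - ε)) ^ k := by
        gcongr
        exact hfu y
    _ = _ := by
        rw [← Real.exp_nat_mul]
        congr 1
        have : (l : ℝ) ≠ 0 := by positivity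
        push_cast [ContinuousMap.smul_apply, smul_eq_mul]
        field_simp

/-- Membership of 0 would give f with φ f = 1 and norm at most exp(-nε) < 1, against contractivity.
-/
lemma zero_notMem_logCone [CompactSpace Y] (hφ : ∀ f : B, ‖φ f‖ ≤ ‖(f : C(Y, ℂ))‖) :
    (0 : C(X, ℝ)) ∉ logCone φ p := by
  rintro ⟨ε, hε, n, hn, f, hf, hfu⟩
  have h1 : ‖(f : C(Y, ℂ))‖ ≤ Real.exp (n * (0 - ε)) :=
    (ContinuousMap.norm_le _ (Real.exp_pos _).le).2 hfu
  have h2 := hφ f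
  rw [hf, norm_one] at h2
  have h3 : Real.exp (n * (0 - ε)) < 1 := by
    rw [Real.exp_lt_one_iff]
    have : (0 : ℝ) < n := by exact_mod_cast hn
    nlinarith
  linarith

lemma mem_logCone_of_norm_le [CompactSpace X] {f : B} {u : C(X, ℝ)} (hf : φ f = 1)
    (hfu : ∀ y, ‖(f : C(Y, ℂ)) y‖ ≤ Real.exp (u (p y))) {δ : ℝ} (hδ : 0 < δ) :
    u + ContinuousMap.const X δ ∈ logCone φ p :=
  ⟨δ, hδ, 1, one_pos, f, hf, fun y => by simpa using hfu y⟩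

variable [CompactSpace X]

lemma isOpen_logCone : IsOpen (logCone φ p) := by
  rw [Metric.isOpen_iff]
  rintro u ⟨ε, hε, n, hn, f, hf, hfu⟩
  refine ⟨ε / 2, by positivity, fun v hv => ⟨ε / 2, by positivity, n, hn, f, hf, fun y => ?_⟩⟩
  refine (hfu y).trans (Real.exp_le_exp.2 ?_)
  have h := (ContinuousMap.dist_apply_le_dist (f := v) (g := u) (p y)).trans_lt hv
  rw [Real.dist_eq, abs_lt] at h
  exact mul_le_mul_of_nonneg_left (by linarith [h.1]) (Nat.cast_nonneg n)

/-- Powers of f yield only rational multiples. For real t, write t • u = q • ((t/q) • u) with q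
rational and so close to t that openness keeps (t/q) • u in the cone. -/
lemma smul_mem_logCone {u : C(X, ℝ)} (hu : u ∈ logCone φ p) {t : ℝ} (ht : 0 < t) :
    t • u ∈ logCone φ p := by
  have hc : Tendsto (fun q : ℝ => (t / q) • u) (𝓝 t) (𝓝 u) := by
    have : ContinuousAt (fun q : ℝ => (t / q) • u) t :=
      (continuousAt_const.div continuousAt_id ht.ne').smul continuousAt_const
    simpa [ContinuousAt, ht.ne'] using this
  obtain ⟨r, hr, hrmem⟩ := Metric.eventually_nhds_iff.1
    (hc.eventually (isOpen_logCone.mem_nhds hu))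
  obtain ⟨q, hq1, hq2⟩ := exists_rat_btwn (show t < t + r by linarith)
  have hq : (0 : ℝ) < q := ht.trans hq1
  have hmem := hrmem (y := (q : ℝ)) (by rw [Real.dist_eq, abs_of_pos (by linarith)]; linarith)
  have hq0 : 0 < q := by exact_mod_cast hq
  have hnum : 0 < q.num := Rat.num_pos.2 hq0
  have hmem' := nat_div_smul_mem_logCone hmem (k := q.num.toNat) (l := q.den) (by omega) q.pos
  have hqeq : ((q.num.toNat : ℕ) : ℝ) / (q.den : ℝ) = q := by
    have h1 : ((q.num.toNat : ℕ) : ℝ) = ((q.num : ℤ) : ℝ) := by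
      exact_mod_cast congrArg (Int.cast (R := ℝ)) (Int.toNat_of_nonneg hnum.le)
    rw [h1]
    exact_mod_cast congrArg (Rat.cast (K := ℝ)) (Rat.num_div_den q)
  rw [hqeq, smul_smul, mul_div_cancel₀ _ hq.ne'] at hmem'
  exact hmem'

lemma convex_logCone : Convex ℝ (logCone φ p) := by
  rw [convex_iff_forall_pos]
  intro u hu v hv a b ha hb _
  exact add_mem_logCone (smul_mem_logCone hu ha) (smul_mem_logCone hv hb)

variable [CompactSpace Y]

variable [T2Space X] [MeasurableSpace X] [BorelSpace X]

/-- A positive linear functional on `C(X, ℝ)`, `X` compact, is given by a regular measure. -/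
lemma exists_regular_measure_of_nonneg (L : C(X, ℝ) →L[ℝ] ℝ)
    (hL : ∀ u : C(X, ℝ), (∀ x, 0 ≤ u x) → 0 ≤ L u) :
    ∃ μ : Measure X, μ.Regular ∧ IsFiniteMeasure μ ∧ ∀ u : C(X, ℝ), ∫ x, u x ∂μ = L u := by
  let Λ : CompactlySupportedContinuousMap X ℝ →ₚ[ℝ] ℝ :=
  { toFun g := L g
    map_add' g g' := L.map_add (g : C(X, ℝ)) g'
    map_smul' c g := L.map_smul c (g : C(X, ℝ))
    monotone' g g' h := by
      have := hL ((g' : C(X, ℝ)) - g) fun x => sub_nonneg.2 (h x)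
      rw [map_sub] at this
      exact sub_nonneg.1 this }
  refine ⟨RealRMK.rieszMeasure Λ, by infer_instance, by infer_instance, fun u => ?_⟩
  exact RealRMK.integral_rieszMeasure Λ
    { toFun := u, hasCompactSupport' := HasCompactSupport.of_compactSpace _ }

/-- Existence of Jensen measures, relative to a continuous map `p`. -/
theorem exists_measure_log_le_integral (hφ : ∀ f : B, ‖φ f‖ ≤ ‖(f : C(Y, ℂ))‖) :
    ∃ μ : Measure X, IsProbabilityMeasure μ ∧ μ.Regular ∧ ∀ (f : B) (u : C(X, ℝ)), φ f ≠ 0 →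
      (∀ y, ‖(f : C(Y, ℂ)) y‖ ≤ Real.exp (u (p y))) → Real.log ‖φ f‖ ≤ ∫ x, u x ∂μ := by
  -- The separating functional is negative on the cone, hence the change of sign to `N` below.
  obtain ⟨M, hM⟩ := geometric_hahn_banach_open_point (convex_logCone (φ := φ) (p := p))
    isOpen_logCone (zero_notMem_logCone hφ)
  have hpos : ∀ u ∈ logCone φ p, 0 < (-M) u := fun u hu => by
    have := hM u hu
    rw [map_zero] at this
    simpa using this
  set N : C(X, ℝ) →L[ℝ] ℝ := -M
  have hconst : ∀ c : ℝ, ContinuousMap.const X c = c • (1 : C(X, ℝ)) := fun c => by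
    ext; simp
  -- Without the slack ε the function u is only a limit of members of the cone, so strict positivity
  -- weakens to `0 ≤ N u`.
  have hnn : ∀ (f : B) (u : C(X, ℝ)), φ f = 1 →
      (∀ y, ‖(f : C(Y, ℂ)) y‖ ≤ Real.exp (u (p y))) → 0 ≤ N u := fun f u hf hfu => by
    have hlim : Tendsto (fun δ : ℝ => N (u + ContinuousMap.const X δ)) (𝓝[>] 0) (𝓝 (N u)) := by
      have : Continuous fun δ : ℝ => N u + δ * N 1 := by fun_prop
      have h := this.tendsto 0
      simp only [zero_mul, add_zero] at h
      simp only [hconst, map_add, map_smul, smul_eq_mul]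
      exact h.mono_left nhdsWithin_le_nhds
    exact ge_of_tendsto hlim (eventually_nhdsWithin_of_forall fun δ hδ =>
      (hpos _ (mem_logCone_of_norm_le hf hfu hδ)).le)
  have hN1 : 0 < N 1 := by
    have := hpos _ (mem_logCone_of_norm_le (φ := φ) (p := p) (f := 1) (u := 0) (map_one _)
      (fun y => by simp) one_pos)
    rwa [zero_add, hconst, one_smul] at this
  obtain ⟨μ, hreg, hfin, hμ⟩ := exists_regular_measure_of_nonneg ((N 1)⁻¹ • N) fun u hu => by
    have := hnn 1 u (map_one _) fun y => by simpa using hu (p y)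
    have h2 := mul_nonneg (inv_nonneg.2 hN1.le) this
    simpa using h2
  refine ⟨μ, ?_, hreg, fun f u hf hfu => ?_⟩
  · have := hμ 1
    simp only [ContinuousMap.one_apply, integral_const, smul_eq_mul, mul_one,
      _root_.smul_apply, inv_mul_cancel₀ hN1.ne'] at this
    refine ⟨?_⟩
    rw [measureReal_def] at this
    rw [← ENNReal.ofReal_toReal (measure_ne_top μ Set.univ), this, ENNReal.ofReal_one]
  -- Normalising f to have φ-value 1 lowers its logarithmic majorant by log |φ f|.
  · have h := hnn ((φ f)⁻¹ • f) (u - ContinuousMap.const X (Real.log ‖φ f‖))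
      ((φ.toLinearMap.map_smul _ _).trans (inv_mul_cancel₀ hf))
      fun y => by
        have hc : 0 < ‖φ f‖ := norm_pos_iff.2 hf
        simp only [ContinuousMap.sub_apply, ContinuousMap.const_apply, Real.exp_sub,
          Real.exp_log hc]
        simp only [Subalgebra.coe_smul, ContinuousMap.smul_apply, smul_eq_mul, norm_mul, norm_inv]
        rw [div_eq_inv_mul]
        gcongr
        exact hfu y
    rw [map_sub, hconst, map_smul, smul_eq_mul] at h
    rw [hμ, _root_.smul_apply, smul_eq_mul, inv_mul_eq_div, le_div_iff₀ hN1]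
    linarith

end JensenMeasures

/-! ### From continuous majorants to the extended integral of log |g| -/

section JensenMeasures

lemma log_enorm_of_ne_zero {c : ℂ} (hc : c ≠ 0) : ENNReal.log ‖c‖ₑ = (Real.log ‖c‖ : ℝ) := by
  rw [← ofReal_norm, ENNReal.log_ofReal_of_pos (norm_pos_iff.2 hc)]

/-- Pointwise convergence of the truncated negative parts, with limit ∞ at c = 0; this is the input
for Fatou's lemma. -/
lemma tendsto_ofReal_neg_log_max (c : ℂ) :
    Tendsto (fun n : ℕ => ENNReal.ofReal (-Real.log (max ‖c‖ (1 / ((n : ℝ) + 1))))) atTop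
      (𝓝 (-(ENNReal.log ‖c‖ₑ)).toENNReal) := by
  by_cases hc : c = 0
  · subst hc
    simp only [enorm_zero, ENNReal.log_zero, EReal.neg_bot, EReal.toENNReal_top, norm_zero]
    refine ENNReal.tendsto_ofReal_nhds_top.2 ?_
    have h : Tendsto (fun n : ℕ => Real.log ((n : ℝ) + 1)) atTop atTop :=
      Real.tendsto_log_atTop.comp (tendsto_atTop_add_const_right _ _ tendsto_natCast_atTop_atTop)
    refine h.congr fun n => ?_
    rw [max_eq_right (by positivity), one_div, Real.log_inv, neg_neg]
  · have hev : ∀ᶠ n : ℕ in atTop, 1 / ((n : ℝ) + 1) < ‖c‖ :=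
      tendsto_one_div_add_atTop_nhds_zero_nat.eventually_lt_const (norm_pos_iff.2 hc)
    refine tendsto_const_nhds.congr' ?_
    filter_upwards [hev] with n hn
    rw [max_eq_left hn.le, log_enorm_of_ne_zero hc, ← EReal.coe_neg, EReal.toENNReal_of_ne_top
      (EReal.coe_ne_top _), EReal.toReal_coe]

variable {X : Type*} [TopologicalSpace X] [CompactSpace X] [MeasurableSpace X] [BorelSpace X]

lemma toENNReal_log_enorm (c : ℂ) :
    (ENNReal.log ‖c‖ₑ).toENNReal = ENNReal.ofReal (Real.posLog ‖c‖) := by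
  by_cases hc : c = 0
  · simp [hc]
  · rw [log_enorm_of_ne_zero hc, EReal.toENNReal_of_ne_top (EReal.coe_ne_top _), EReal.toReal_coe,
      Real.posLog_apply, ENNReal.ofReal_max, ENNReal.ofReal_zero, max_eq_right zero_le]

/-- If `log |c|` is at most `∫ u` for each continuous `u` above `log |g|`, then it is at most
`∫ log |g|`. -/
lemma log_enorm_le_eintegral (μ : Measure X) [IsProbabilityMeasure μ] (g : C(X, ℂ)) {c : ℂ}
    (h : c ≠ 0 → ∀ u : C(X, ℝ), (∀ x, ‖g x‖ ≤ Real.exp (u x)) → Real.log ‖c‖ ≤ ∫ x, u x ∂μ) :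
    ENNReal.log ‖c‖ₑ ≤ eintegral μ (fun x => ENNReal.log ‖g x‖ₑ) := by
  by_cases hc : c = 0
  · simp [hc]
  have hPc : Continuous fun x => Real.posLog ‖g x‖ := by fun_prop
  have hPi : Integrable (fun x => Real.posLog ‖g x‖) μ :=
    hPc.integrable_of_hasCompactSupport (HasCompactSupport.of_compactSpace _)
  set P : ℝ := ∫ x, Real.posLog ‖g x‖ ∂μ with hP
  have hP0 : 0 ≤ P := integral_nonneg fun x => Real.posLog_nonneg
  have hpos : ∫⁻ x, (ENNReal.log ‖g x‖ₑ).toENNReal ∂μ = ENNReal.ofReal P := by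
    simp_rw [toENNReal_log_enorm]
    rw [ofReal_integral_eq_lintegral_ofReal hPi (ae_of_all _ fun x => Real.posLog_nonneg)]
  -- The hypothesis is applied to the continuous truncation log max(|g|, δ). As δ ≤ 1, truncation
  -- leaves the positive part alone, so the bound on the negative part is uniform in n.
  have hlt : ∀ n : ℕ, ∫⁻ x, ENNReal.ofReal (-Real.log (max ‖g x‖ (1 / ((n : ℝ) + 1)))) ∂μ
      ≤ ENNReal.ofReal (P - Real.log ‖c‖) := fun n => by
    set δ : ℝ := 1 / ((n : ℝ) + 1)
    have hδ : 0 < δ := by positivity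
    have hδ1 : δ ≤ 1 := by
      rw [div_le_one (by positivity)]
      linarith [(Nat.cast_nonneg n : (0 : ℝ) ≤ n)]
    have hm : ∀ x, 0 < max ‖g x‖ δ := fun x => lt_max_of_lt_right hδ
    let u : C(X, ℝ) := ⟨fun x => Real.log (max ‖g x‖ δ),
      Continuous.log (by fun_prop) fun x => (hm x).ne'⟩
    have hu := h hc u fun x => by
      simp only [u, ContinuousMap.coe_mk, Real.exp_log (hm x)]
      exact le_max_left _ _
    have hui : Integrable (fun x => u x) μ :=
      u.continuous.integrable_of_hasCompactSupport (HasCompactSupport.of_compactSpace _)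
    have hval : ∀ x, max (-u x) 0 = Real.posLog ‖g x‖ - u x := fun x => by
      have hpl : Real.posLog ‖g x‖ = max 0 (u x) := by
        simp only [u, ContinuousMap.coe_mk]
        rcases le_total δ ‖g x‖ with hle | hle
        · rw [max_eq_left hle, Real.posLog_apply]
        · rw [max_eq_right hle, max_eq_left (Real.log_nonpos hδ.le hδ1),
            Real.posLog_eq_zero_iff, abs_of_nonneg (norm_nonneg _)]
          exact hle.trans hδ1
      rw [hpl]
      rcases le_total 0 (u x) with h0 | h0
      · rw [max_eq_right (by linarith), max_eq_right h0, sub_self]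
      · rw [max_eq_left (by linarith), max_eq_left h0, zero_sub]
    have hle : ∫⁻ x, ENNReal.ofReal (-u x) ∂μ = ENNReal.ofReal (P - ∫ x, u x ∂μ) := by
      have h0 : ∀ x, 0 ≤ Real.posLog ‖g x‖ - u x := fun x => hval x ▸ le_max_right _ _
      have hi : Integrable (fun x => Real.posLog ‖g x‖ - u x) μ := hPi.sub hui
      rw [hP, ← integral_sub hPi hui, ofReal_integral_eq_lintegral_ofReal hi (ae_of_all _ h0)]
      refine lintegral_congr fun x => ?_
      rw [← hval, ENNReal.ofReal_max, ENNReal.ofReal_zero, max_eq_left zero_le]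
    exact hle.le.trans (ENNReal.ofReal_le_ofReal (by linarith))
  have hneg : ∫⁻ x, (-(ENNReal.log ‖g x‖ₑ)).toENNReal ∂μ ≤ ENNReal.ofReal (P - Real.log ‖c‖) := by
    calc _ = ∫⁻ x, liminf (fun n : ℕ =>
          ENNReal.ofReal (-Real.log (max ‖g x‖ (1 / ((n : ℝ) + 1))))) atTop ∂μ :=
          lintegral_congr fun x => (tendsto_ofReal_neg_log_max (g x)).liminf_eq.symm
      _ ≤ liminf (fun n : ℕ => ∫⁻ x,
          ENNReal.ofReal (-Real.log (max ‖g x‖ (1 / ((n : ℝ) + 1)))) ∂μ) atTop :=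
          lintegral_liminf_le fun n => by
            have := g.continuous.measurable
            fun_prop
      _ ≤ _ := liminf_le_of_le (by isBoundedDefault) fun b hb => by
          obtain ⟨n, hn⟩ := hb.exists
          exact hn.trans (hlt n)
  have hPc0 : 0 ≤ P - Real.log ‖c‖ := by
    let u : C(X, ℝ) := ⟨fun x => Real.posLog ‖g x‖, hPc⟩
    refine sub_nonneg.2 (h hc u fun x => ?_)
    refine (Real.le_exp_log _).trans (Real.exp_le_exp.2 ?_)
    exact le_max_right _ _
  rw [eintegral, hpos, log_enorm_of_ne_zero hc]
  refine le_trans ?_ (EReal.sub_le_sub le_rfl (EReal.coe_ennreal_le_coe_ennreal_iff.2 hneg))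
  rw [EReal.coe_ennreal_ofReal, EReal.coe_ennreal_ofReal, max_eq_left hP0, max_eq_left hPc0,
    ← EReal.coe_sub, EReal.coe_le_coe_iff]
  linarith

variable [T2Space X] {Y : Type*} [TopologicalSpace Y] [CompactSpace Y]

/-- Every character on `B` has a measure on `X` which is a Jensen measure for the characters that
it induces on subalgebras of `C(X)` and bounds it by continuous functions of `p`. -/
theorem exists_isJensenMeasure {B : Subalgebra ℂ C(Y, ℂ)} {φ : B →ₐ[ℂ] ℂ} {p : C(Y, X)}
    (hφ : ∀ f : B, ‖φ f‖ ≤ ‖(f : C(Y, ℂ))‖) {A : Subalgebra ℂ C(X, ℂ)} (j : A →ₐ[ℂ] B)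
    (hj : ∀ a y, (j a : C(Y, ℂ)) y = (a : C(X, ℂ)) (p y)) :
    ∃ μ : Measure X, IsJensenMeasure A (φ.comp j) μ ∧ ∀ (f : B) (u : C(X, ℝ)), φ f ≠ 0 →
      (∀ y, ‖(f : C(Y, ℂ)) y‖ ≤ Real.exp (u (p y))) → Real.log ‖φ f‖ ≤ ∫ x, u x ∂μ := by
  obtain ⟨μ, hprob, hreg, hμ⟩ := exists_measure_log_le_integral (p := p) hφ
  refine ⟨μ, ⟨hprob, hreg, fun a => ?_⟩, hμ⟩
  refine log_enorm_le_eintegral μ _ fun ha u hu => hμ (j a) u ha fun y => ?_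
  rw [hj]
  exact hu _

end JensenMeasures

/-! ### Characters of R(X) and their values on coordinates -/

section RationalHull

variable {n : ℕ} (X : Set (Fin n → ℂ))

/-- The restriction of a polynomial to `X`. -/
noncomputable def polyMap (a : MvPolynomial (Fin n) ℂ) : C(X, ℂ) :=
  ⟨fun x => MvPolynomial.eval x.1 a, (MvPolynomial.continuous_eval a).comp continuous_subtype_val⟩

lemma polyMap_mem (a : MvPolynomial (Fin n) ℂ) : polyMap X a ∈ rationalFunctions X :=
  ⟨a, 1, fun x => by simp [polyMap]⟩

variable [CompactSpace X]

lemma rationalFunctions_le_R : rationalFunctions X ≤ R X :=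
  Subalgebra.le_topologicalClosure _

/-- Restriction of polynomials to `X`, as a homomorphism to `R(X)`. -/
noncomputable def polyHom : MvPolynomial (Fin n) ℂ →ₐ[ℂ] R X where
  toFun a := ⟨polyMap X a, rationalFunctions_le_R X (polyMap_mem X a)⟩
  map_one' := by ext; simp [polyMap]
  map_mul' a b := by ext; simp [polyMap]
  map_zero' := by ext; simp [polyMap]
  map_add' a b := by ext; simp [polyMap]
  commutes' r := by ext; simp [polyMap]

variable {X}

@[simp]
lemma polyHom_apply (a : MvPolynomial (Fin n) ℂ) (x : X) :
    (polyHom X a : C(X, ℂ)) x = MvPolynomial.eval x.1 a := rfl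

lemma character_polyHom (φ : R X →ₐ[ℂ] ℂ) (a : MvPolynomial (Fin n) ℂ) :
    φ (polyHom X a) = MvPolynomial.eval (fun i => φ (polyHom X (MvPolynomial.X i))) a := by
  have h : φ.comp (polyHom X) = MvPolynomial.aeval fun i => φ (polyHom X (MvPolynomial.X i)) := by
    ext i; simp
  exact (DFunLike.congr_fun h a).trans (by simp [MvPolynomial.aeval_eq_eval])

lemma isClosed_R : IsClosed (R X : Set C(X, ℂ)) :=
  Subalgebra.isClosed_topologicalClosure _

lemma norm_character_le {Y : Type*} [TopologicalSpace Y] [CompactSpace Y]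
    {B : Subalgebra ℂ C(Y, ℂ)} (hB : IsClosed (B : Set C(Y, ℂ))) (φ : B →ₐ[ℂ] ℂ) (f : B) :
    ‖φ f‖ ≤ ‖(f : C(Y, ℂ))‖ := by
  have : CompleteSpace B := hB.completeSpace_coe
  -- Only an inequality, since Y may be empty.
  have h1 : ‖(1 : B)‖ ≤ 1 :=
    (ContinuousMap.norm_le (1 : C(Y, ℂ)) zero_le_one).2 fun y => by simp
  calc ‖φ f‖ ≤ ‖f‖ * ‖(1 : B)‖ := AlgHom.norm_apply_le_self_mul_norm_one φ f
    _ ≤ ‖f‖ * 1 := by gcongr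
    _ = ‖(f : C(Y, ℂ))‖ := mul_one _

/-- A character on `R(X)` whose values on the coordinate functions are the coordinates of a point
`x` of `X` is the evaluation at `x`. -/
lemma character_eq_eval (φ : R X →ₐ[ℂ] ℂ) (x : X)
    (hx : ∀ i, φ (polyHom X (MvPolynomial.X i)) = x.1 i) (f : R X) :
    φ f = (f : C(X, ℂ)) x := by
  have hx' : (fun i => φ (polyHom X (MvPolynomial.X i))) = x.1 := funext hx
  have hrat : ∀ g : R X, (g : C(X, ℂ)) ∈ rationalFunctions X → φ g = (g : C(X, ℂ)) x := by
    rintro g ⟨a, b, hab⟩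
    -- Clearing the denominator reduces the claim to polynomials; b(x) ≠ 0 allows dividing back.
    have hmul : g * polyHom X b = polyHom X a := by
      ext y
      simp only [MulMemClass.coe_mul, ContinuousMap.mul_apply, polyHom_apply]
      rw [(hab y).2, div_mul_cancel₀ _ (hab y).1]
    have h := congrArg φ hmul
    rw [map_mul, character_polyHom, character_polyHom, hx'] at h
    rw [(hab x).2, eq_div_iff (hab x).1, h]
  refine eq_of_dist_eq_zero (le_antisymm (le_of_forall_pos_le_add fun ε hε => ?_) dist_nonneg)
  obtain ⟨g, hg, hfg⟩ := Metric.mem_closure_iff.1 f.2 (ε / 2) (by positivity)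
  have hgR : g ∈ R X := rationalFunctions_le_R X hg
  have h1 : ‖φ (f - ⟨g, hgR⟩)‖ ≤ ‖(f : C(X, ℂ)) - g‖ := norm_character_le isClosed_R φ _
  have h2 : ‖((f : C(X, ℂ)) - g) x‖ ≤ ‖(f : C(X, ℂ)) - g‖ := ContinuousMap.norm_coe_le_norm _ x
  rw [map_sub, hrat ⟨g, hgR⟩ hg] at h1
  rw [dist_eq_norm] at hfg
  rw [dist_eq_norm, zero_add]
  calc ‖φ f - (f : C(X, ℂ)) x‖ = ‖(φ f - g x) - ((f : C(X, ℂ)) - g) x‖ := by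
        congr 1; simp
    _ ≤ ‖φ f - g x‖ + ‖((f : C(X, ℂ)) - g) x‖ := norm_sub_le _ _
    _ ≤ ε := by linarith

end RationalHull

/-! ### Naturality of R(X_K) -/

section Sphere

variable {K : Set ℂ}

lemma one_sub_sq_pos {z : ℂ} (hz : ‖z‖ < 1) : 0 < 1 - ‖z‖ ^ 2 := by
  nlinarith [norm_nonneg z]

/-- The radius of the fibre over `z` of the unit sphere of `ℂ²`. -/
noncomputable def fibreRadius (z : ℂ) : ℝ := √(1 - ‖z‖ ^ 2)

@[fun_prop]
lemma continuous_fibreRadius : Continuous fibreRadius := by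
  unfold fibreRadius
  fun_prop

lemma fibreRadius_pos {z : ℂ} (hz : ‖z‖ < 1) : 0 < fibreRadius z :=
  Real.sqrt_pos.2 (one_sub_sq_pos hz)

lemma norm_snd_eq_fibreRadius (y : XK K) : ‖y.1 1‖ = fibreRadius (y.1 0) := by
  rw [fibreRadius, ← y.2.2, add_sub_cancel_left, Real.sqrt_sq (norm_nonneg _)]

lemma mem_XK_of_norm_eq {v : Fin 2 → ℂ} (h0 : v 0 ∈ K) (h1 : ‖v 0‖ < 1)
    (h : ‖v 1‖ = fibreRadius (v 0)) : v ∈ XK K := by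
  refine ⟨h0, ?_⟩
  rw [h, fibreRadius, Real.sq_sqrt (one_sub_sq_pos h1).le]
  ring

lemma snd_ne_zero (hdisc : K ⊆ Metric.ball (0 : ℂ) 1) (y : XK K) : y.1 1 ≠ 0 := by
  rw [← norm_pos_iff, norm_snd_eq_fibreRadius]
  exact fibreRadius_pos (by simpa using hdisc y.2.1)

variable [CompactSpace K]

lemma planeRationalFunctions_le_planeR : planeRationalFunctions K ≤ planeR K :=
  Subalgebra.le_topologicalClosure _

lemma comp_proj_mem_R {g : C(K, ℂ)} (hg : g ∈ planeR K) : g.comp (XK.proj K) ∈ R (XK K) := by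
  refine map_mem_closure (f := fun g : C(K, ℂ) => g.comp (XK.proj K))
    (ContinuousMap.continuous_precomp _) hg ?_
  rintro g ⟨a, b, h⟩
  refine ⟨a.toMvPolynomial 0, b.toMvPolynomial 0, fun y => ?_⟩
  simp only [MvPolynomial.eval_toMvPolynomial]
  exact h (XK.proj K y)

/-- Composition with the projection, as a homomorphism from `R(K)` to `R(X_K)`. -/
noncomputable def pullback (K : Set ℂ) [CompactSpace K] : planeR K →ₐ[ℂ] R (XK K) :=
  ((ContinuousMap.compRightAlgHom ℂ ℂ (XK.proj K)).comp (planeR K).val).codRestrict (R (XK K))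
    fun g => comp_proj_mem_R g.2

lemma pullback_apply (g : planeR K) (y : XK K) :
    (pullback K g : C(XK K, ℂ)) y = (g : C(K, ℂ)) (XK.proj K y) := rfl

theorem isNatural_R_XK (hdisc : K ⊆ Metric.ball (0 : ℂ) 1)
    (hJensen : NoNontrivialJensenMeasures (planeR K)) : IsNatural (R (XK K)) := by
  intro φ
  have hdisc' : ∀ z : K, ‖(z : ℂ)‖ < 1 := fun z => by simpa using hdisc z.2
  obtain ⟨μ, hμ, hle⟩ := exists_isJensenMeasure (norm_character_le isClosed_R φ)
    (pullback K) pullback_apply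
  obtain ⟨x, rfl⟩ := hJensen _ μ hμ
  have hle' : ∀ (f : R (XK K)) (u : C(K, ℝ)), φ f ≠ 0 →
      (∀ y, ‖(f : C(XK K, ℂ)) y‖ ≤ Real.exp (u (XK.proj K y))) → Real.log ‖φ f‖ ≤ u x :=
    fun f u hf hfu => by simpa using hle f u hf hfu
  set v : Fin 2 → ℂ := fun i => φ (polyHom (XK K) (MvPolynomial.X i)) with hv
  have hv0 : v 0 = x := by
    -- With d = |φ(z) - x| > 0, the majorant log max(|z - x|, d/2) of log |z - x| has value log(d/2)
    -- at x, which would force d ≤ d/2.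
    by_contra hne
    have hd : 0 < ‖v 0 - x‖ := norm_pos_iff.2 (sub_ne_zero.2 hne)
    have hm : ∀ z : K, 0 < max ‖(z : ℂ) - x‖ (‖v 0 - x‖ / 2) :=
      fun z => lt_max_of_lt_right (by positivity)
    have hφ : φ (polyHom (XK K) (MvPolynomial.X 0 - MvPolynomial.C (x : ℂ))) = v 0 - x := by
      rw [character_polyHom]; simp [hv]
    have h := hle' (polyHom (XK K) (MvPolynomial.X 0 - MvPolynomial.C (x : ℂ)))
      ⟨fun z => Real.log (max ‖(z : ℂ) - x‖ (‖v 0 - x‖ / 2)),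
        Continuous.log (by fun_prop) fun z => (hm z).ne'⟩
      (by rw [hφ]; exact sub_ne_zero.2 hne)
      (fun y => by
        rw [polyHom_apply, map_sub, MvPolynomial.eval_X, MvPolynomial.eval_C,
          ContinuousMap.coe_mk, Real.exp_log (hm _)]
        exact le_max_left (‖y.1 0 - x‖) _)
    simp only [hφ, ContinuousMap.coe_mk, sub_self, norm_zero] at h
    rw [max_eq_right (by positivity), Real.log_le_log_iff hd (by positivity)] at h
    linarith
  have hr : ∀ z : K, 0 < fibreRadius z := fun z => fibreRadius_pos (hdisc' z)
  -- As K lies in the open disc, w has no zero on X_K and is invertible in R(X_K).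
  let winv : C(XK K, ℂ) := ⟨fun y => (y.1 1)⁻¹,
    ((continuous_apply 1).comp continuous_subtype_val).inv₀ fun y => snd_ne_zero hdisc y⟩
  have hwinv : winv ∈ R (XK K) := rationalFunctions_le_R _
    ⟨1, MvPolynomial.X 1, fun y => by simpa [winv] using snd_ne_zero hdisc y⟩
  have hmul : v 1 * φ ⟨winv, hwinv⟩ = 1 := by
    rw [hv, ← map_mul, ← map_one φ]
    congr 1
    ext y
    simpa [winv] using mul_inv_cancel₀ (snd_ne_zero hdisc y)
  have hv1 : v 1 ≠ 0 := left_ne_zero_of_mul_eq_one hmul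
  let logr : C(K, ℝ) := ⟨fun z => Real.log (fibreRadius z),
    Continuous.log (by fun_prop) fun z => (hr z).ne'⟩
  -- The bound for w gives |φ(w)| ≤ r(x), the bound for 1/w the reverse inequality.
  have h1 : Real.log ‖v 1‖ ≤ Real.log (fibreRadius x) := by
    refine hle' _ logr hv1 fun y => ?_
    simp only [logr, ContinuousMap.coe_mk, Real.exp_log (hr _), polyHom_apply,
      MvPolynomial.eval_X]
    exact (norm_snd_eq_fibreRadius y).le
  have h2 : Real.log ‖φ ⟨winv, hwinv⟩‖ ≤ -Real.log (fibreRadius x) := by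
    refine hle' _ (-logr) (right_ne_zero_of_mul_eq_one hmul) fun y => ?_
    simp only [logr, ContinuousMap.coe_mk, ContinuousMap.neg_apply, Real.exp_neg,
      Real.exp_log (hr _), winv, norm_inv]
    rw [norm_snd_eq_fibreRadius]
    rfl
  rw [eq_inv_of_mul_eq_one_right hmul, norm_inv, Real.log_inv, neg_le_neg_iff] at h2
  have hnorm : ‖v 1‖ = fibreRadius x :=
    Real.log_injOn_pos (norm_pos_iff.2 hv1) (hr x) (le_antisymm h1 h2)
  have hmem : v ∈ XK K := mem_XK_of_norm_eq (hv0 ▸ x.2) (hv0 ▸ hdisc' x) (hv0.symm ▸ hnorm)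
  exact ⟨⟨v, hmem⟩, character_eq_eval φ ⟨v, hmem⟩ fun i => rfl⟩

end Sphere

/-! ### The Cauchy-Pompeiu formula -/

section CauchyPompeiu

/-- Twice the Wirtinger derivative `∂g/∂z̄`. -/
noncomputable def dbar (g : ℂ → ℂ) (ζ : ℂ) : ℂ :=
  fderiv ℝ g ζ 1 + Complex.I * fderiv ℝ g ζ Complex.I

lemma dbar_eq_zero_of_differentiableAt {g : ℂ → ℂ} {ζ : ℂ} (h : DifferentiableAt ℂ g ζ) :
    dbar g ζ = 0 := by
  have hI : fderiv ℂ g ζ Complex.I = Complex.I * fderiv ℂ g ζ 1 := by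
    simp
  rw [dbar, h.fderiv_restrictScalars ℝ, ContinuousLinearMap.coe_restrictScalars', hI,
    ← mul_assoc, Complex.I_mul_I]
  ring

lemma dbar_congr {g h : ℂ → ℂ} {ζ : ℂ} (hgh : g =ᶠ[𝓝 ζ] h) : dbar g ζ = dbar h ζ := by
  rw [dbar, dbar, hgh.fderiv_eq]

variable {g : ℂ → ℂ}

lemma continuous_fderiv_comp (hg : ContDiff ℝ 1 g) {α : Type*} [TopologicalSpace α] {f v : α → ℂ}
    (hf : Continuous f) (hv : Continuous v) : Continuous fun x => fderiv ℝ g (f x) (v x) :=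
  ((hg.continuous_fderiv one_ne_zero).comp hf).clm_apply hv

lemma continuous_dbar (hg : ContDiff ℝ 1 g) : Continuous (dbar g) :=
  (continuous_fderiv_comp hg continuous_id continuous_const).add
    (continuous_const.mul (continuous_fderiv_comp hg continuous_id continuous_const))

/-- The point with polar coordinates `q` around `z`. -/
noncomputable def polarPoint (z : ℂ) (q : ℝ × ℝ) : ℂ :=
  z + q.1 * Complex.exp (q.2 * Complex.I)

/-- The bound involves |ρ| because the function along a ray is later treated as compactly supported
on the whole line. -/
lemma exists_forall_polarPoint_eq_zero {F : ℂ → ℂ} (hF : HasCompactSupport F) (z : ℂ) :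
    ∃ R : ℝ, ∀ q : ℝ × ℝ, R < |q.1| → polarPoint z q ∉ tsupport F := by
  obtain ⟨R, hR⟩ := hF.isCompact.isBounded.subset_closedBall z
  refine ⟨R, fun q hq hmem => ?_⟩
  have := hR hmem
  rw [Metric.mem_closedBall, dist_eq_norm, polarPoint, add_sub_cancel_left, norm_mul,
    Complex.norm_exp_ofReal_mul_I, mul_one, Complex.norm_real, Real.norm_eq_abs] at this
  linarith

/-- The Cauchy-Pompeiu formula for compactly supported functions. -/
theorem integral_dbar_div_sub (hg : ContDiff ℝ 1 g) (hs : HasCompactSupport g) (z : ℂ) :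
    ∫ ζ, dbar g ζ / (ζ - z) = -(2 * Real.pi) * g z := by
  set e : ℝ → ℂ := fun θ => Complex.exp (θ * Complex.I) with he
  have hec : Continuous e := by fun_prop
  set P : ℝ × ℝ → ℂ := polarPoint z with hP
  have hPc : Continuous P := by unfold P polarPoint; fun_prop
  -- The Jacobian ρ cancels the singularity. What remains is A = ∂g/∂ρ plus B = (i/ρ) ∂g/∂θ: A
  -- integrates to -g(z) along each ray, and B to 0 around each circle by periodicity.
  set A : ℝ × ℝ → ℂ := fun q => fderiv ℝ g (P q) (e q.2) with hA
  set B : ℝ × ℝ → ℂ := fun q => Complex.I * fderiv ℝ g (P q) (Complex.I * e q.2) with hB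
  have hAc : Continuous A := continuous_fderiv_comp hg hPc (hec.comp continuous_snd)
  have hBc : Continuous B := continuous_const.mul (continuous_fderiv_comp hg hPc
    (continuous_const.mul (hec.comp continuous_snd)))
  obtain ⟨R, hR⟩ := exists_forall_polarPoint_eq_zero hs z
  have hd0 : ∀ q : ℝ × ℝ, R < |q.1| → fderiv ℝ g (P q) = 0 := fun q hq =>
    image_eq_zero_of_notMem_tsupport fun h => hR q hq (tsupport_fderiv_subset ℝ h)
  have hint : ∀ F : ℝ × ℝ → ℂ, Continuous F → (∀ q, R < |q.1| → F q = 0) →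
      IntegrableOn F (Set.Ioi 0 ×ˢ Set.Ioo (-Real.pi) Real.pi) := by
    intro F hF hF0
    have hcpt : IntegrableOn F (Set.Icc 0 R ×ˢ Set.Icc (-Real.pi) Real.pi) :=
      hF.continuousOn.integrableOn_compact (isCompact_Icc.prod isCompact_Icc)
    refine hcpt.of_forall_sdiff_eq_zero (measurableSet_Ioi.prod measurableSet_Ioo) ?_
    rintro q ⟨⟨h1, h2⟩, h3⟩
    refine hF0 q ?_
    by_contra hle
    exact h3 ⟨⟨le_of_lt h1, (le_abs_self _).trans (not_lt.1 hle)⟩, Set.Ioo_subset_Icc_self h2⟩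
  have hAi := hint A hAc fun q hq => by simp [hA, hd0 q hq]
  have hBi := hint B hBc fun q hq => by simp [hB, hd0 q hq]
  have hpolar : ∀ q ∈ polarCoord.target,
      q.1 • (dbar g (z + Complex.polarCoord.symm q) / (z + Complex.polarCoord.symm q - z)) =
        A q + B q := by
    rintro q ⟨hq, -⟩
    have hq' : ((q.1 : ℝ) : ℂ) ≠ 0 := Complex.ofReal_ne_zero.2 (ne_of_gt hq)
    have hsymm : Complex.polarCoord.symm q = q.1 * e q.2 := by
      rw [Complex.polarCoord_symm_apply, he]
      simp only [Complex.exp_mul_I, Complex.ofReal_cos, Complex.ofReal_sin]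
    have he1 : e q.2 = Real.cos q.2 + Real.sin q.2 * Complex.I := by
      simp only [he, Complex.exp_mul_I, Complex.ofReal_cos, Complex.ofReal_sin]
    have hL1 : fderiv ℝ g (P q) (e q.2) =
        Real.cos q.2 * fderiv ℝ g (P q) 1 + Real.sin q.2 * fderiv ℝ g (P q) Complex.I := by
      have : e q.2 = Real.cos q.2 • (1 : ℂ) + Real.sin q.2 • Complex.I := by
        rw [he1]; simp
      rw [this, map_add, map_smul, map_smul, Complex.real_smul, Complex.real_smul]
    have hL2 : fderiv ℝ g (P q) (Complex.I * e q.2) =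
        Real.cos q.2 * fderiv ℝ g (P q) Complex.I - Real.sin q.2 * fderiv ℝ g (P q) 1 := by
      have : Complex.I * e q.2 = Real.cos q.2 • Complex.I - Real.sin q.2 • (1 : ℂ) := by
        rw [he1]; simp only [Complex.real_smul]; linear_combination Real.sin q.2 * Complex.I_sq
      rw [this, map_sub, map_smul, map_smul, Complex.real_smul, Complex.real_smul]
    have hexp : e q.2 ≠ 0 := Complex.exp_ne_zero _
    have hPq : z + Complex.polarCoord.symm q = P q := by rw [hsymm]; rfl
    rw [hPq, Complex.real_smul, show P q - z = q.1 * e q.2 by simp [hP, polarPoint, he], dbar]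
    simp only [hA, hB]
    rw [hL1, hL2]
    field_simp
    rw [he1]
    have hcs : (Real.cos q.2 : ℂ) ^ 2 + (Real.sin q.2 : ℂ) ^ 2 = 1 := by
      exact_mod_cast Real.cos_sq_add_sin_sq q.2
    linear_combination (-(fderiv ℝ g (P q) 1 + Complex.I * fderiv ℝ g (P q) Complex.I)) * hcs +
      (fderiv ℝ g (P q) 1 * Real.sin q.2 ^ 2 -
        fderiv ℝ g (P q) Complex.I * Real.cos q.2 * Real.sin q.2) * Complex.I_sq
  have hAint : ∫ q in Set.Ioi (0 : ℝ) ×ˢ Set.Ioo (-Real.pi) Real.pi, A q =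
      -(2 * Real.pi) * g z := by
    have hswap := setIntegral_prod_swap (μ := (volume : Measure ℝ)) (ν := (volume : Measure ℝ))
      (Set.Ioi (0 : ℝ)) (Set.Ioo (-Real.pi) Real.pi) A
    rw [Measure.volume_eq_prod] at hAi ⊢
    rw [← hswap, setIntegral_prod (fun q : ℝ × ℝ => A q.swap) hAi.swap]
    have hinner : ∀ θ : ℝ, ∫ ρ in Set.Ioi (0 : ℝ), A (ρ, θ) = -g z := fun θ => by
      have hG : ContDiff ℝ 1 fun ρ : ℝ => g (P (ρ, θ)) :=
        hg.comp (contDiff_const.add (Complex.ofRealCLM.contDiff.mul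
          (contDiff_const (c := e θ))))
      have hder : ∀ ρ : ℝ, HasDerivAt (fun ρ : ℝ => g (P (ρ, θ))) (A (ρ, θ)) ρ := fun ρ => by
        have h1 : HasDerivAt (fun ρ : ℝ => P (ρ, θ)) (e θ) ρ := by
          simpa [hP, polarPoint, he] using
            ((Complex.ofRealCLM.hasDerivAt (x := ρ)).mul_const (e θ)).const_add z
        exact ((hg.differentiable one_ne_zero (P (ρ, θ))).hasFDerivAt).comp_hasDerivAt ρ h1
      have hcs : HasCompactSupport fun ρ : ℝ => g (P (ρ, θ)) := by
        refine HasCompactSupport.of_support_subset_isCompact (isCompact_Icc (a := -R) (b := R)) ?_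
        intro ρ hρ
        rw [Set.mem_Icc, ← abs_le]
        by_contra hlt
        exact hρ (image_eq_zero_of_notMem_tsupport (hR (ρ, θ) (not_le.1 hlt)))
      have := hcs.integral_Ioi_deriv_eq hG 0
      simp only [fun ρ => (hder ρ).deriv] at this
      rw [this]
      simp [hP, polarPoint]
    simp only [Prod.swap, hinner]
    rw [setIntegral_const, measureReal_def, Real.volume_Ioo,
      ENNReal.toReal_ofReal (by linarith [Real.pi_pos]), Complex.real_smul]
    push_cast
    ring
  have hBint : ∫ q in Set.Ioi (0 : ℝ) ×ˢ Set.Ioo (-Real.pi) Real.pi, B q = 0 := by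
    rw [Measure.volume_eq_prod] at hBi ⊢
    rw [setIntegral_prod _ hBi]
    refine setIntegral_eq_zero_of_forall_eq_zero fun ρ hρ => ?_
    have hρ' : ((ρ : ℝ) : ℂ) ≠ 0 := Complex.ofReal_ne_zero.2 (ne_of_gt hρ)
    have hder : ∀ θ : ℝ, HasDerivAt (fun θ : ℝ => Complex.I / ρ * g (P (ρ, θ))) (B (ρ, θ)) θ :=
      fun θ => by
        have h0 : HasDerivAt e (e θ * Complex.I) θ := by
          have := (Complex.ofRealCLM.hasDerivAt (x := θ)).mul_const Complex.I
          simpa [he] using this.cexp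
        have h1 : HasDerivAt (fun θ : ℝ => P (ρ, θ)) (ρ • (Complex.I * e θ)) θ := by
          have := (h0.const_mul (ρ : ℂ)).const_add z
          simpa [hP, polarPoint, he, mul_comm] using this
        have h2 := (((hg.differentiable one_ne_zero (P (ρ, θ))).hasFDerivAt).comp_hasDerivAt θ
          h1).const_mul (Complex.I / ρ)
        refine h2.congr_deriv ?_
        rw [map_smul, Complex.real_smul]
        simp only [hB]
        field_simp
    show ∫ θ in Set.Ioo (-Real.pi) Real.pi, B (ρ, θ) = 0
    rw [← integral_Ioc_eq_integral_Ioo,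
      ← intervalIntegral.integral_of_le (by linarith [Real.pi_pos]),
      intervalIntegral.integral_eq_sub_of_hasDerivAt (fun θ _ => hder θ)
        (Continuous.intervalIntegrable (by fun_prop) _ _)]
    simp [hP, polarPoint, Complex.exp_neg]
  rw [← integral_add_right_eq_self (μ := (volume : Measure ℂ)) _ z]
  rw [← Complex.integral_comp_polarCoord_symm]
  simp only [add_comm _ z]
  rw [setIntegral_congr_fun polarCoord.open_target.measurableSet hpolar]
  rw [polarCoord_target, integral_add hAi hBi, hAint, hBint, add_zero]

end CauchyPompeiu

/-! ### Functions holomorphic near K belong to R(K) -/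

section Runge

/-- The cutoff is 1 on a neighbourhood of K, not just on K, so that ∂̄(χh) vanishes near K. -/
lemma exists_smooth_cutoff {K U : Set ℂ} (hK : IsCompact K) (hU : IsOpen U) (hKU : K ⊆ U) :
    ∃ χ : ℂ → ℝ, ContDiff ℝ 1 χ ∧ HasCompactSupport χ ∧ tsupport χ ⊆ U ∧
      ∀ x ∈ K, ∀ᶠ y in 𝓝 x, χ y = 1 := by
  obtain ⟨L, hL, hKL, hLU⟩ := exists_compact_between hK hU hKU
  obtain ⟨χ, h1, h0, -⟩ := exists_contMDiffMap_one_nhds_of_subset_interior (n := 1)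
    (modelWithCornersSelf ℝ ℂ) hK.isClosed hKL
  have hts : tsupport χ ⊆ L := closure_minimal
    (fun x hx => by_contra fun hxL => hx (h0 x hxL)) hL.isClosed
  exact ⟨χ, χ.contMDiff.contDiff, hL.of_isClosed_subset (isClosed_tsupport _) hts,
    hts.trans hLU, fun x hx => mem_nhdsSet_iff_forall.1 h1 x hx⟩

variable {K : Set ℂ} [CompactSpace K]

lemma isClosed_planeR : IsClosed (planeR K : Set C(K, ℂ)) :=
  Subalgebra.isClosed_topologicalClosure _

/-- R(K) is closed, hence complete, so the Bochner integral can be formed inside it. -/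
lemma integral_mem_planeR {Φ : ℂ → C(K, ℂ)} (hΦ : Continuous Φ) (hs : HasCompactSupport Φ)
    (hmem : ∀ ζ, Φ ζ ∈ planeR K) : ∫ ζ, Φ ζ ∈ planeR K := by
  have : CompleteSpace (planeR K) := isClosed_planeR.completeSpace_coe
  let Ψ : ℂ → planeR K := fun ζ => ⟨Φ ζ, hmem ζ⟩
  have hΨ : Continuous Ψ := hΦ.subtype_mk _
  have hΨs : HasCompactSupport Ψ := by
    refine HasCompactSupport.of_support_subset_isCompact hs fun ζ hζ => subset_tsupport _ ?_
    exact fun h => hζ (Subtype.ext h)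
  have h := (planeR K).toSubmodule.subtypeL.integral_comp_comm
    (hΨ.integrable_of_hasCompactSupport (μ := volume) hΨs)
  have h' : ∫ ζ, Φ ζ = ((∫ ζ, Ψ ζ : planeR K) : C(K, ℂ)) := h
  rw [h']
  exact Subtype.property _

/-- A weak form of Runge's theorem: functions holomorphic near `K` belong to `R(K)`. -/
theorem mem_planeR_of_differentiableOn {U : Set ℂ} (hU : IsOpen U) (hKU : K ⊆ U) {h : ℂ → ℂ}
    (hh : DifferentiableOn ℂ h U) (f : C(K, ℂ)) (hf : ∀ z : K, f z = h z) : f ∈ planeR K := by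
  have hK : IsCompact K := isCompact_iff_compactSpace.2 inferInstance
  obtain ⟨χ, hχ, hχs, hχU, hχ1⟩ := exists_smooth_cutoff hK hU hKU
  set g : ℂ → ℂ := fun z => (χ z : ℂ) * h z with hg
  have hgs : tsupport g ⊆ tsupport χ := closure_mono fun z hz hz' => hz (by simp [hg, hz'])
  have hgcs : HasCompactSupport g := hχs.of_isClosed_subset (isClosed_tsupport _) hgs
  have hgd : ContDiff ℝ 1 g := contDiff_iff_contDiffAt.2 fun z => by
    by_cases hz : z ∈ U
    · have h1 : ContDiffAt ℂ 1 h z := (hh.analyticAt (hU.mem_nhds hz)).contDiffAt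
      exact (Complex.ofRealCLM.contDiff.contDiffAt.comp z hχ.contDiffAt).mul (h1.restrict_scalars ℝ)
    · have h0 : g =ᶠ[𝓝 z] fun _ => 0 :=
        notMem_tsupport_iff_eventuallyEq.1 fun hz' => hz (hχU (hgs hz'))
      exact contDiffAt_const.congr_of_eventuallyEq h0
  have hgh : ∀ x ∈ K, ∀ᶠ z in 𝓝 x, dbar g z = 0 := fun x hx => by
    filter_upwards [eventually_eventually_nhds.2 (hχ1 x hx), hU.mem_nhds (hKU hx)] with z hz hzU
    have : g =ᶠ[𝓝 z] h := by
      filter_upwards [hz] with w hw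
      simp [hg, hw]
    rw [dbar_congr this]
    exact dbar_eq_zero_of_differentiableAt (hh.differentiableAt (hU.mem_nhds hzU))
  have hdc : Continuous (dbar g) := continuous_dbar hgd
  have hds : HasCompactSupport (dbar g) := by
    refine HasCompactSupport.of_support_subset_isCompact hgcs fun z hz => ?_
    by_contra hz'
    refine hz ?_
    have := image_eq_zero_of_notMem_tsupport fun h => hz' (tsupport_fderiv_subset ℝ h)
    simp [dbar, this]
  -- The kernel is singular only on the diagonal, where ζ lies in K and `dbar g` vanishes nearby.
  -- Each slice in ζ is thus zero or a rational function with its pole off K.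
  have hcont : Continuous fun q : ℂ × K => dbar g q.1 * (q.1 - q.2)⁻¹ := by
    refine continuous_iff_continuousAt.2 fun q => ?_
    by_cases hq : q.1 = q.2
    · have hev : ∀ᶠ r : ℂ × K in 𝓝 q, dbar g r.1 = 0 := by
        have h1 : ∀ᶠ ζ in 𝓝 q.1, dbar g ζ = 0 := hgh q.1 (hq ▸ q.2.2)
        exact continuous_fst.continuousAt.eventually h1
      refine (continuousAt_const (y := (0 : ℂ))).congr ?_
      filter_upwards [hev] with r hr
      rw [hr, zero_mul]
    · exact (hdc.comp continuous_fst).continuousAt.mul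
        (ContinuousAt.inv₀ (by fun_prop) (sub_ne_zero.2 hq))
  let Φ : C(ℂ, C(K, ℂ)) := ContinuousMap.curry ⟨_, hcont⟩
  have hΦ : ∀ ζ z, Φ ζ z = dbar g ζ * (ζ - z)⁻¹ := fun ζ z => rfl
  have hΦ0 : ∀ ζ, dbar g ζ = 0 → Φ ζ = 0 := fun ζ hζ => by
    ext z
    rw [hΦ, hζ, zero_mul, ContinuousMap.zero_apply]
  have hΦs : HasCompactSupport Φ :=
    HasCompactSupport.of_support_subset_isCompact hds fun ζ hζ =>
      subset_tsupport _ fun h => hζ (hΦ0 ζ h)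
  have hmem : ∀ ζ, Φ ζ ∈ planeR K := fun ζ => by
    by_cases hζ : ζ ∈ K
    · rw [hΦ0 ζ (hgh ζ hζ).self_of_nhds]
      exact zero_mem _
    · refine planeRationalFunctions_le_planeR ⟨Polynomial.C (dbar g ζ),
        Polynomial.C ζ - Polynomial.X, fun z => ⟨?_, ?_⟩⟩
      · simpa [sub_eq_zero] using fun hz : ζ = z => hζ (hz ▸ z.2)
      · simp [hΦ, div_eq_mul_inv]
  have hint := integral_mem_planeR Φ.continuous hΦs hmem
  have hf' : f = (-(2 * Real.pi : ℂ))⁻¹ • ∫ ζ, Φ ζ := by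
    ext z
    have hgz : g z = f z := by
      rw [hf, hg]
      simp [(hχ1 z z.2).self_of_nhds]
    have h1 : (∫ ζ, Φ ζ) z = ∫ ζ, Φ ζ z :=
      ((ContinuousMap.evalCLM ℝ z).integral_comp_comm
        (Φ.continuous.integrable_of_hasCompactSupport hΦs)).symm
    have h2 := integral_dbar_div_sub hgd hgcs z
    simp only [div_eq_mul_inv] at h2
    have hpi : (-(2 * Real.pi : ℂ)) ≠ 0 := by simp [Real.pi_ne_zero]
    rw [ContinuousMap.smul_apply, h1]
    simp only [hΦ]
    rw [h2, smul_eq_mul, inv_mul_cancel_left₀ hpi, hgz]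
  rw [hf']
  exact Subalgebra.smul_mem _ hint _

end Runge

/-! ### Holomorphic dependence of circle averages on a parameter -/

section CircleAverages

open Real (circleAverage)

/-- Differentiation under the integral sign for circle averages of holomorphic functions. -/
theorem differentiableAt_circleAverage {F : ℂ × ℂ → ℂ} {W : Set (ℂ × ℂ)} (hW : IsOpen W)
    (hF : DifferentiableOn ℂ F W) {z₀ : ℂ} {ρ : ℝ}
    (hz₀ : ∀ w ∈ Metric.sphere (0 : ℂ) |ρ|, (z₀, w) ∈ W) :
    DifferentiableAt ℂ (fun z => circleAverage (fun w => F (z, w)) 0 ρ) z₀ := by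
  have hsph : IsCompact (Metric.sphere (0 : ℂ) |ρ|) := isCompact_sphere _ _
  have hev : ∀ᶠ z in 𝓝 z₀, ∀ w ∈ Metric.sphere (0 : ℂ) |ρ|, (z, w) ∈ W :=
    hsph.eventually_forall_of_forall_eventually fun w hw => hW.mem_nhds (hz₀ w hw)
  obtain ⟨ε, hε, hball⟩ := Metric.nhds_basis_closedBall.eventually_iff.1 hev
  have hsub : Metric.closedBall z₀ ε ×ˢ Metric.sphere (0 : ℂ) |ρ| ⊆ W :=
    fun q hq => hball hq.1 q.2 hq.2
  obtain ⟨M, hM⟩ := ((isCompact_closedBall z₀ ε).prod hsph).exists_bound_of_continuousOn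
    (hF.continuousOn.mono hsub)
  have hmemW : ∀ z ∈ Metric.closedBall z₀ ε, ∀ θ : ℝ, (z, circleMap 0 ρ θ) ∈ W :=
    fun z hz θ => hball hz _ (circleMap_mem_sphere' 0 ρ θ)
  have hcont : ∀ z ∈ Metric.closedBall z₀ ε, Continuous fun θ : ℝ => F (z, circleMap 0 ρ θ) :=
    fun z hz => hF.continuousOn.comp_continuous (by fun_prop) fun θ => hmemW z hz θ
  have hdiff : ∀ z ∈ Metric.closedBall z₀ ε, ∀ θ : ℝ,
      DifferentiableAt ℂ (fun z => F (z, circleMap 0 ρ θ)) z := fun z hz θ =>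
    (hF.differentiableAt (hW.mem_nhds (hmemW z hz θ))).comp z
      (differentiableAt_id.prodMk (differentiableAt_const _))
  have hmem₀ : z₀ ∈ Metric.closedBall z₀ ε := Metric.mem_closedBall_self hε.le
  set F' : ℂ → ℝ → ℂ := fun z θ => deriv (fun z => F (z, circleMap 0 ρ θ)) z with hF'
  -- Cauchy's estimate on discs of radius ε/2, which stay in the closed ε-ball where |F| ≤ M.
  have hbound : ∀ θ : ℝ, ∀ z ∈ Metric.ball z₀ (ε / 2), ‖F' z θ‖ ≤ M / (ε / 2) := by
    intro θ z hz
    have hcb : Metric.closedBall z (ε / 2) ⊆ Metric.closedBall z₀ ε :=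
      Metric.closedBall_subset_closedBall' (by linarith [Metric.mem_ball.1 hz])
    refine Complex.norm_deriv_le_of_forall_mem_sphere_norm_le (by positivity) ?_ fun x hx =>
      hM (x, circleMap 0 ρ θ)
        ⟨hcb (Metric.sphere_subset_closedBall hx), circleMap_mem_sphere' 0 ρ θ⟩
    refine DifferentiableOn.diffContOnCl_ball (U := Metric.closedBall z₀ ε) ?_ hcb
    exact fun x hx => (hdiff x hx θ).differentiableWithinAt
  -- The derivative is a pointwise limit of continuous difference quotients; the increments ε/(n+1)
  -- do not leave the ε-ball.
  have hmeas : StronglyMeasurable (F' z₀) := by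
    let t : ℕ → ℂ := fun n => ((ε / ((n : ℝ) + 1) : ℝ) : ℂ)
    have ht0 : Tendsto t atTop (𝓝[≠] 0) := by
      refine tendsto_nhdsWithin_iff.2 ⟨?_, Eventually.of_forall fun n => ?_⟩
      · have : Tendsto (fun n : ℕ => ε / ((n : ℝ) + 1)) atTop (𝓝 0) :=
          tendsto_const_div_atTop_nhds_zero_nat ε |>.comp (tendsto_add_atTop_nat 1) |>.congr
            fun n => by simp
        have h := (Complex.continuous_ofReal.tendsto 0).comp this
        rwa [Complex.ofReal_zero] at h
      · exact Complex.ofReal_ne_zero.2 (by positivity)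
    have htmem : ∀ n, z₀ + t n ∈ Metric.closedBall z₀ ε := fun n => by
      rw [Metric.mem_closedBall, dist_eq_norm, add_sub_cancel_left, Complex.norm_real,
        Real.norm_of_nonneg (by positivity)]
      exact div_le_self hε.le (by linarith [(Nat.cast_nonneg n : (0 : ℝ) ≤ n)])
    refine stronglyMeasurable_of_tendsto (u := atTop)
      (f := fun n θ => (t n)⁻¹ • (F (z₀ + t n, circleMap 0 ρ θ) - F (z₀, circleMap 0 ρ θ)))
      (fun n => Continuous.stronglyMeasurable (by
        exact ((hcont _ (htmem n)).sub (hcont _ hmem₀)).const_smul (t n)⁻¹)) ?_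
    exact tendsto_pi_nhds.2 fun θ =>
      ((hdiff z₀ hmem₀ θ).hasDerivAt.tendsto_slope_zero).comp ht0
  have hmain := intervalIntegral.hasDerivAt_integral_of_dominated_loc_of_deriv_le
    (μ := volume) (a := 0) (b := 2 * Real.pi) (F := fun z θ => F (z, circleMap 0 ρ θ)) (F' := F')
    (x₀ := z₀) (bound := fun _ => M / (ε / 2)) (Metric.ball_mem_nhds z₀ (half_pos hε))
    (by
      filter_upwards [Metric.closedBall_mem_nhds z₀ hε] with z hz
      exact (hcont z hz).aestronglyMeasurable)
    ((hcont _ hmem₀).intervalIntegrable _ _) hmeas.aestronglyMeasurable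
    (Eventually.of_forall fun θ _ z hz => hbound θ z hz)
    intervalIntegrable_const
    (Eventually.of_forall fun θ _ z hz => (hdiff z (Metric.closedBall_subset_closedBall
      (by linarith) (Metric.ball_subset_closedBall hz)) θ).hasDerivAt)
  exact hmain.2.differentiableAt.const_smul (2 * Real.pi)⁻¹

/-- The circle averages of a function holomorphic near an annulus agree. -/
lemma circleAverage_eq_of_differentiable_on_annulus {f : ℂ → ℂ} {r R : ℝ} (hr : 0 < r)
    (hR : 0 < R) (hf : ∀ w : ℂ, min r R ≤ ‖w‖ → ‖w‖ ≤ max r R → DifferentiableAt ℂ f w) :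
    circleAverage f 0 r = circleAverage f 0 R := by
  wlog hle : r ≤ R generalizing r R
  · exact (this hR hr (by rwa [min_comm, max_comm]) (le_of_not_ge hle)).symm
  rw [min_eq_left hle, max_eq_right hle] at hf
  rw [Real.circleAverage_eq_circleIntegral hr.ne', Real.circleAverage_eq_circleIntegral hR.ne']
  congr 1
  refine (Complex.circleIntegral_sub_center_inv_smul_eq_of_differentiable_on_annulus_off_countable
    hr hle Set.countable_empty (fun w hw => ?_) fun w hw => ?_).symm
  · refine (hf w ?_ ?_).continuousAt.continuousWithinAt
    · simpa using hw.2
    · simpa using hw.1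
  · refine hf w ?_ ?_
    · have := hw.1.2
      simp only [Metric.mem_closedBall, dist_zero_right, not_le] at this
      exact this.le
    · have := hw.1.1
      simp only [Metric.mem_ball, dist_zero_right] at this
      exact this.le

/-- Circle averages over circles of varying radius are holomorphic, although the radius is not. -/
theorem differentiableAt_circleAverage_of_radius {F : ℂ × ℂ → ℂ} {W : Set (ℂ × ℂ)} (hW : IsOpen W)
    (hF : DifferentiableOn ℂ F W) {z₀ : ℂ} {r : ℂ → ℝ} (hr : ContinuousAt r z₀) (hr₀ : 0 < r z₀)
    (hz₀ : ∀ w ∈ Metric.sphere (0 : ℂ) (r z₀), (z₀, w) ∈ W) :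
    DifferentiableAt ℂ (fun z => circleAverage (fun w => F (z, w)) 0 (r z)) z₀ := by
  -- Writing each circle as its radius times the unit circle lets one compactness argument treat z
  -- and the radius together.
  have hev : ∀ᶠ q : ℂ × ℝ in 𝓝 (z₀, r z₀), ∀ s ∈ Metric.sphere (0 : ℂ) 1,
      (q.1, (q.2 : ℂ) * s) ∈ W := by
    refine (isCompact_sphere _ _).eventually_forall_of_forall_eventually fun s hs => ?_
    have hc : Continuous fun p : (ℂ × ℝ) × ℂ => (p.1.1, (p.1.2 : ℂ) * p.2) := by fun_prop
    refine hc.continuousAt.eventually (hW.mem_nhds (hz₀ _ ?_))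
    have hs' : ‖s‖ = 1 := by simpa using hs
    simp [abs_of_pos hr₀, hs']
  obtain ⟨δ, hδ, hδW⟩ := Metric.eventually_nhds_iff.1 hev
  have hnear : ∀ z w : ℂ, dist z z₀ < δ → 0 < ‖w‖ → |‖w‖ - r z₀| < δ → (z, w) ∈ W := by
    intro z w hz hw hwδ
    have h := hδW (y := (z, ‖w‖)) (by rw [Prod.dist_eq]; exact max_lt hz hwδ) ((‖w‖ : ℂ)⁻¹ * w)
      (by simp [hw.ne'])
    have hw' : (‖w‖ : ℂ) ≠ 0 := Complex.ofReal_ne_zero.2 hw.ne'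
    rwa [mul_inv_cancel_left₀ hw'] at h
  -- For z near z₀ the annulus between the radii r z and r z₀ lies in the slice of W over z, so the
  -- radius can be frozen at r z₀.
  have heq : (fun z => circleAverage (fun w => F (z, w)) 0 (r z)) =ᶠ[𝓝 z₀]
      fun z => circleAverage (fun w => F (z, w)) 0 (r z₀) := by
    filter_upwards [Metric.ball_mem_nhds z₀ hδ, hr.eventually (lt_mem_nhds hr₀),
      hr.eventually (Metric.ball_mem_nhds (r z₀) hδ)] with z hz hrz hrδ
    refine circleAverage_eq_of_differentiable_on_annulus hrz hr₀ fun w hw1 hw2 => ?_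
    have hrδ' : |r z - r z₀| < δ := hrδ
    rw [abs_lt] at hrδ'
    have hmem : (z, w) ∈ W := by
      refine hnear z w hz ((lt_min hrz hr₀).trans_le hw1) (abs_lt.2 ⟨?_, ?_⟩)
      · rcases min_le_iff.1 hw1 with h | h <;> linarith
      · rcases le_max_iff.1 hw2 with h | h <;> linarith
    exact (hF.differentiableAt (hW.mem_nhds hmem)).comp w
      ((differentiableAt_const _).prodMk differentiableAt_id)
  refine DifferentiableAt.congr_of_eventuallyEq ?_ heq
  exact differentiableAt_circleAverage hW hF (by rwa [abs_of_pos hr₀])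

end CircleAverages

/-! ### Fibre averages of rational functions -/

section Averaging

variable {K : Set ℂ}

lemma differentiable_eval_pair (a : MvPolynomial (Fin 2) ℂ) :
    Differentiable ℂ fun q : ℂ × ℂ => MvPolynomial.eval ![q.1, q.2] a := by
  induction a using MvPolynomial.induction_on with
  | C c => simp
  | add p q hp hq => simpa only [map_add] using Differentiable.fun_add hp hq
  | mul_X p i hp =>
    simp only [map_mul, MvPolynomial.eval_X]
    refine Differentiable.fun_mul hp ?_
    fin_cases i
    · exact differentiable_fst
    · exact differentiable_snd

variable [CompactSpace K]

/-- The fibrewise averages of a rational function without poles on `X_K` belong to `R(K)`. -/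
theorem circleAverage_mem_planeR (hdisc : K ⊆ Metric.ball (0 : ℂ) 1)
    (a b : MvPolynomial (Fin 2) ℂ)
    (hb : ∀ z ∈ K, ∀ w : ℂ, ‖w‖ = fibreRadius z → MvPolynomial.eval ![z, w] b ≠ 0)
    (g : C(K, ℂ)) (hg : ∀ z : K, g z = Real.circleAverage
      (fun w => MvPolynomial.eval ![(z : ℂ), w] a / MvPolynomial.eval ![(z : ℂ), w] b) 0
      (fibreRadius z)) : g ∈ planeR K := by
  set W : Set (ℂ × ℂ) := {q | MvPolynomial.eval ![q.1, q.2] b ≠ 0} with hWdef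
  have hW : IsOpen W := isOpen_ne_fun (differentiable_eval_pair b).continuous continuous_const
  have hF : DifferentiableOn ℂ
      (fun q : ℂ × ℂ => MvPolynomial.eval ![q.1, q.2] a / MvPolynomial.eval ![q.1, q.2] b) W := by
    simp only [div_eq_mul_inv]
    refine DifferentiableOn.fun_mul (differentiable_eval_pair a).differentiableOn
      (DifferentiableOn.fun_inv (differentiable_eval_pair b).differentiableOn ?_)
    exact fun q hq => hq
  -- The z for which the denominator has no zero on the circle of radius `fibreRadius z`. Below, V
  -- is intersected with the open disc, where that radius is positive.
  set V : Set ℂ := {z | ∀ s ∈ Metric.sphere (0 : ℂ) 1, (z, (fibreRadius z : ℂ) * s) ∈ W}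
  have hV : IsOpen V := isOpen_iff_eventually.2 fun z hz =>
    (isCompact_sphere _ _).eventually_forall_of_forall_eventually fun s hs => by
      have hc : Continuous fun p : ℂ × ℂ => (p.1, (fibreRadius p.1 : ℂ) * p.2) := by fun_prop
      exact hc.continuousAt.eventually (hW.mem_nhds (hz s hs))
  refine mem_planeR_of_differentiableOn (hV.inter Metric.isOpen_ball) (fun z hz => ⟨?_, hdisc hz⟩)
    (h := fun z => Real.circleAverage
      (fun w => MvPolynomial.eval ![z, w] a / MvPolynomial.eval ![z, w] b) 0 (fibreRadius z))
    ?_ g hg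
  · intro s hs
    refine hb z hz _ ?_
    have hs' : ‖s‖ = 1 := by simpa using hs
    rw [norm_mul, hs', mul_one, Complex.norm_real, fibreRadius,
      Real.norm_of_nonneg (Real.sqrt_nonneg _)]
  · rintro z ⟨hz, hz1⟩
    have hpos : 0 < fibreRadius z := fibreRadius_pos (by simpa using hz1)
    refine (differentiableAt_circleAverage_of_radius hW hF
      continuous_fibreRadius.continuousAt hpos fun w hw => ?_).differentiableWithinAt
    have hne : (fibreRadius z : ℂ) ≠ 0 := Complex.ofReal_ne_zero.2 hpos.ne'
    have hw' : ‖w‖ = fibreRadius z := by simpa using hw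
    have h := hz ((fibreRadius z : ℂ)⁻¹ * w)
      (by simp [hw', abs_of_pos hpos, hpos.ne'])
    rwa [mul_inv_cancel_left₀ hne] at h

end Averaging

/-! ### Haar measure on the circle as arc length -/

section HaarCircle

/-- The normalised Haar measure of the circle group is the normalised arc length. -/
theorem haarIntegral_circle {g : Circle → ℂ} (hg : Continuous g) :
    haarIntegral Circle g = (2 * Real.pi : ℝ)⁻¹ • ∫ θ in (0)..2 * Real.pi, g (Circle.exp θ) := by
  let _ : MeasurableSpace Circle := borel Circle
  have _ : BorelSpace Circle := ⟨rfl⟩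
  set μ : Measure Circle :=
    Measure.haarMeasure (⊤ : TopologicalSpace.PositiveCompacts Circle) with hμ
  have hprob : IsProbabilityMeasure μ := ⟨Measure.haarMeasure_self⟩
  have hI : haarIntegral Circle g = ∫ s, g s ∂μ := rfl
  obtain ⟨M, hM⟩ := isCompact_univ.exists_bound_of_continuousOn hg.continuousOn
  have hcont : Continuous fun q : Circle × ℝ => g (q.1 * Circle.exp q.2) :=
    hg.comp (continuous_fst.mul (Circle.exp.continuous.comp continuous_snd))
  have hint : Integrable (fun q : Circle × ℝ => g (q.1 * Circle.exp q.2))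
      (μ.prod (volume.restrict (Set.Ioc 0 (2 * Real.pi)))) :=
    Integrable.of_bound hcont.aestronglyMeasurable M (Eventually.of_forall fun q =>
      hM _ (Set.mem_univ _))
  have hle : (0 : ℝ) ≤ 2 * Real.pi := by positivity
  -- The double integral of g(s e^{iθ}) is computed in both orders: periodicity removes s, and Haar
  -- invariance removes θ.
  have hshift : ∀ s : Circle, ∫ θ in (0)..2 * Real.pi, g (s * Circle.exp θ) =
      ∫ θ in (0)..2 * Real.pi, g (Circle.exp θ) := fun s => by
    obtain ⟨α, rfl⟩ := Circle.exp_surjective s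
    have hper : Function.Periodic (fun θ : ℝ => g (Circle.exp θ)) (2 * Real.pi) :=
      fun θ => by simp only [Circle.periodic_exp θ]
    simp only [← Circle.exp_add]
    rw [intervalIntegral.integral_comp_add_left (fun θ => g (Circle.exp θ)) α, add_zero]
    exact (hper.intervalIntegral_add_eq α 0).trans (by rw [zero_add])
  have h1 : ∫ s, (∫ θ in Set.Ioc 0 (2 * Real.pi), g (s * Circle.exp θ)) ∂μ =
      ∫ θ in (0)..2 * Real.pi, g (Circle.exp θ) := by
    simp only [← intervalIntegral.integral_of_le hle, hshift]
    simp
  have h2 : ∫ θ in Set.Ioc 0 (2 * Real.pi), (∫ s, g (s * Circle.exp θ) ∂μ) =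
      (2 * Real.pi) • ∫ s, g s ∂μ := by
    simp only [integral_mul_right_eq_self (μ := μ) g]
    rw [setIntegral_const, measureReal_def, Real.volume_Ioc, sub_zero, ENNReal.toReal_ofReal hle]
  rw [hI, ← h1, integral_integral_swap hint, h2, inv_smul_smul₀ (by positivity)]

lemma haarIntegral_circle_mul_right (g : Circle → ℂ) (t : Circle) :
    haarIntegral Circle (fun s => g (s * t)) = haarIntegral Circle g := by
  let _ : MeasurableSpace Circle := borel Circle
  have _ : BorelSpace Circle := ⟨rfl⟩
  exact integral_mul_right_eq_self
    (μ := Measure.haarMeasure (⊤ : TopologicalSpace.PositiveCompacts Circle)) g t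

end HaarCircle

/-! ### The circle action and the averaging operator -/

section Extension

variable {K : Set ℂ}

/-- The action of the circle group on `X_K` by rotations of the second coordinate. -/
@[reducible]
noncomputable def rotation (K : Set ℂ) : MulAction Circle (XK K) where
  smul s v := ⟨![v.1 0, (s : ℂ) * v.1 1], v.2.1, by
    change ‖v.1 0‖ ^ 2 + ‖(s : ℂ) * v.1 1‖ ^ 2 = 1
    rw [norm_mul, Circle.norm_coe, one_mul]
    exact v.2.2⟩
  one_smul v := by
    refine Subtype.ext (funext fun i => ?_)
    fin_cases i
    · rfl
    · exact one_mul _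
  mul_smul s t v := by
    refine Subtype.ext (funext fun i => ?_)
    fin_cases i
    · rfl
    · exact mul_assoc (s : ℂ) t (v.1 1)

attribute [local instance] rotation

lemma coe_rotation_smul (s : Circle) (v : XK K) :
    ((s • v : XK K) : Fin 2 → ℂ) = ![v.1 0, (s : ℂ) * v.1 1] := rfl

lemma continuous_pair {α : Type*} [TopologicalSpace α] {f g : α → ℂ} (hf : Continuous f)
    (hg : Continuous g) : Continuous fun x => (![f x, g x] : Fin 2 → ℂ) :=
  continuous_pi fun i => by
    fin_cases i
    · exact hf
    · exact hg

instance continuousSMul_rotation : ContinuousSMul Circle (XK K) where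
  continuous_smul := by
    refine Continuous.subtype_mk (continuous_pair ?_ ?_) _
    · exact (continuous_apply 0).comp (continuous_subtype_val.comp continuous_snd)
    · exact (continuous_subtype_val.comp continuous_fst).mul
        ((continuous_apply 1).comp (continuous_subtype_val.comp continuous_snd))

lemma proj_smul (s : Circle) (v : XK K) : XK.proj K (s • v) = XK.proj K v := rfl

/-- The section `z ↦ (z, √(1 - |z|²))` of the projection. -/
noncomputable def fibreSection (hdisc : K ⊆ Metric.ball (0 : ℂ) 1) : C(K, XK K) where
  toFun z := ⟨![z, fibreRadius z], mem_XK_of_norm_eq (by simp)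
    (by simpa using hdisc z.2) (by
      simp [abs_of_pos (fibreRadius_pos (by simpa using hdisc z.2))])⟩
  continuous_toFun := (continuous_pair continuous_subtype_val (by fun_prop)).subtype_mk _

variable (hdisc : K ⊆ Metric.ball (0 : ℂ) 1)

lemma proj_fibreSection (z : K) : XK.proj K (fibreSection hdisc z) = z := rfl

lemma coe_smul_fibreSection (s : Circle) (z : K) :
    ((s • fibreSection hdisc z : XK K) : Fin 2 → ℂ) = ![(z : ℂ), (s : ℂ) * fibreRadius z] := rfl

/-- Every point of `X_K` is obtained from the section by a rotation. -/
lemma exists_smul_fibreSection (y : XK K) :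
    ∃ s : Circle, s • fibreSection hdisc (XK.proj K y) = y := by
  have hr : 0 < fibreRadius (y.1 0) := fibreRadius_pos (by simpa using hdisc y.2.1)
  have hne : (fibreRadius (y.1 0) : ℂ) ≠ 0 := Complex.ofReal_ne_zero.2 hr.ne'
  refine ⟨⟨y.1 1 / fibreRadius (y.1 0), ?_⟩, Subtype.ext (funext fun i => ?_)⟩
  · rw [Submonoid.unitSphere, Submonoid.mem_mk, Subsemigroup.mem_mk, mem_sphere_zero_iff_norm,
      norm_div, norm_snd_eq_fibreRadius, Complex.norm_real, Real.norm_of_nonneg hr.le, div_self hr.ne']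
  · fin_cases i
    · rfl
    · exact div_mul_cancel₀ (y.1 1) hne

variable [CompactSpace K]

/-- Averaging over the fibres of the projection. -/
noncomputable def fibreAverage : C(XK K, ℂ) →L[ℂ] C(K, ℂ) :=
  LinearMap.mkContinuous
    { toFun := fun f =>
        ⟨fun z => (2 * Real.pi : ℝ)⁻¹ • ∫ θ in (0)..2 * Real.pi,
            f (Circle.exp θ • fibreSection hdisc z),
          Continuous.fun_const_smul
            (intervalIntegral.continuous_parametric_intervalIntegral_of_continuous'
              (f := fun z θ => f (Circle.exp θ • fibreSection hdisc z))
              (f.continuous.comp ((Circle.exp.continuous.comp continuous_snd).smul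
                ((fibreSection hdisc).continuous.comp continuous_fst))) _ _) _⟩
      map_add' := fun f g => by
        ext z
        have hint : ∀ h : C(XK K, ℂ), IntervalIntegrable
            (fun θ : ℝ => h (Circle.exp θ • fibreSection hdisc z)) volume 0 (2 * Real.pi) :=
          fun h => Continuous.intervalIntegrable (h.continuous.comp
            (Circle.exp.continuous.smul continuous_const)) _ _
        simp only [ContinuousMap.coe_mk, ContinuousMap.add_apply]
        rw [intervalIntegral.integral_add (hint f) (hint g), smul_add]
      map_smul' := fun c f => by
        ext z
        simp only [ContinuousMap.coe_mk, ContinuousMap.smul_apply, RingHom.id_apply]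
        rw [intervalIntegral.integral_smul, smul_comm] }
    1 fun f => by
      rw [one_mul]
      refine (ContinuousMap.norm_le _ (norm_nonneg f)).2 fun z => ?_
      have h := intervalIntegral.norm_integral_le_of_norm_le_const (a := 0) (b := 2 * Real.pi)
        (f := fun θ : ℝ => f (Circle.exp θ • fibreSection hdisc z)) (C := ‖f‖)
        fun θ _ => f.norm_coe_le_norm _
      have hpi : (0 : ℝ) < 2 * Real.pi := by positivity
      rw [sub_zero, abs_of_pos hpi] at h
      simp only [LinearMap.coe_mk, AddHom.coe_mk, ContinuousMap.coe_mk]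
      rw [norm_smul, Real.norm_of_nonneg (by positivity), inv_mul_le_iff₀ hpi,
        mul_comm (2 * Real.pi)]
      exact h

lemma fibreAverage_apply (f : C(XK K, ℂ)) (z : K) :
    fibreAverage hdisc f z = (2 * Real.pi : ℝ)⁻¹ • ∫ θ in (0)..2 * Real.pi,
      f (Circle.exp θ • fibreSection hdisc z) := rfl

lemma fibreAverage_comp_proj (g : C(K, ℂ)) : fibreAverage hdisc (g.comp (XK.proj K)) = g := by
  ext z
  have hpi : (2 * Real.pi : ℝ) ≠ 0 := by positivity
  rw [fibreAverage_apply]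
  simp only [ContinuousMap.comp_apply, proj_smul, proj_fibreSection]
  rw [intervalIntegral.integral_const, sub_zero, inv_smul_smul₀ hpi]

/-- The average is based at the section; y differs from the section by a rotation, which invariance
of Haar measure absorbs. -/
lemma fibreAverage_eq_haarIntegral (f : C(XK K, ℂ)) (y : XK K) :
    fibreAverage hdisc f (XK.proj K y) = haarIntegral Circle fun s => f (s • y) := by
  obtain ⟨t, ht⟩ := exists_smul_fibreSection hdisc y
  have h := haarIntegral_circle_mul_right
    (fun s => f (s • fibreSection hdisc (XK.proj K y))) t
  simp only [mul_smul, ht] at h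
  rw [h]
  exact (haarIntegral_circle (f.continuous.comp (continuous_id.smul continuous_const))).symm

/-- The lower bound comes from T 1 = 1, and needs K non-empty for the constant 1 to have norm 1. -/
lemma norm_fibreAverage [Nonempty K] : ‖fibreAverage hdisc‖ = 1 := by
  have hone : fibreAverage hdisc 1 = 1 := fibreAverage_comp_proj hdisc 1
  have : Nonempty (XK K) := ‹Nonempty K›.map (fibreSection hdisc)
  refine le_antisymm (LinearMap.mkContinuous_norm_le _ zero_le_one _) ?_
  have h := (fibreAverage hdisc).le_opNorm 1
  rwa [hone, norm_one, norm_one, mul_one] at h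

/-- On rational functions T is a circle average over the fibre; continuity of T and closedness of
R(K) extend the inclusion to R(X_K). -/
lemma fibreAverage_mem_planeR {f : C(XK K, ℂ)} (hf : f ∈ R (XK K)) :
    fibreAverage hdisc f ∈ planeR K := by
  have hmaps : ∀ f ∈ rationalFunctions (XK K), fibreAverage hdisc f ∈ planeR K := by
    rintro f ⟨a, b, hab⟩
    refine circleAverage_mem_planeR hdisc a b (fun z hz w hw => ?_) _ fun z => ?_
    · exact (hab ⟨![z, w], mem_XK_of_norm_eq hz (by simpa using hdisc hz) hw⟩).1
    · rw [fibreAverage_apply, Real.circleAverage_def]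
      congr 1
      refine intervalIntegral.integral_congr fun θ _ => ?_
      simp only [(hab _).2, coe_smul_fibreSection, circleMap, zero_add, Circle.coe_exp,
        mul_comm (fibreRadius z : ℂ)]
  exact closure_minimal (s := (rationalFunctions (XK K) : Set C(XK K, ℂ)))
    (t := fibreAverage hdisc ⁻¹' (planeR K : Set C(K, ℂ))) hmaps
    (isClosed_planeR.preimage (fibreAverage hdisc).continuous) hf

lemma isUniformAlgebra_planeR : IsUniformAlgebra (planeR K) where
  isClosed := isClosed_planeR
  separatesPoints z w hzw := by
    refine ⟨_, ⟨⟨fun z => (z : ℂ), continuous_subtype_val⟩,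
      planeRationalFunctions_le_planeR ⟨Polynomial.X, 1, fun z => by simp⟩, rfl⟩, ?_⟩
    exact fun h => hzw (Subtype.ext h)

lemma isUniformAlgebra_R {n : ℕ} (X : Set (Fin n → ℂ)) [CompactSpace X] :
    IsUniformAlgebra (R X) where
  isClosed := isClosed_R
  separatesPoints x y hxy := by
    obtain ⟨i, hi⟩ := Function.ne_iff.1 (Subtype.coe_ne_coe.2 hxy)
    exact ⟨_, ⟨polyHom X (MvPolynomial.X i), Subtype.property _, rfl⟩, by simpa using hi⟩

theorem isGenColeExtension_fibreAverage [Nonempty K] :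
    IsGenColeExtension (planeR K) (R (XK K)) (XK.proj K) (fibreAverage hdisc) where
  isUniformAlgebra_base := isUniformAlgebra_planeR
  isUniformAlgebra_ext := isUniformAlgebra_R _
  surjective z := ⟨fibreSection hdisc z, rfl⟩
  map_one := fibreAverage_comp_proj hdisc 1
  norm_eq_one := norm_fibreAverage hdisc
  map_comp := fibreAverage_comp_proj hdisc
  image_eq := by
    refine Set.Subset.antisymm ?_ fun g hg =>
      ⟨g.comp (XK.proj K), comp_proj_mem_R hg, fibreAverage_comp_proj hdisc g⟩
    rintro _ ⟨f, hf, rfl⟩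
    exact fibreAverage_mem_planeR hdisc hf

theorem isImplementedBy_rotation [Nonempty K] :
    IsImplementedBy Circle (planeR K) (R (XK K)) (XK.proj K) (fibreAverage hdisc) where
  isGenColeExtension := isGenColeExtension_fibreAverage hdisc
  continuous_action := continuousSMul_rotation
  orbit_eq y := by
    ext x
    refine ⟨?_, fun hx => ?_⟩
    · rintro ⟨s, rfl⟩
      rfl
    · have hx' : XK.proj K x = XK.proj K y := hx
      obtain ⟨s, hs⟩ := exists_smul_fibreSection hdisc x
      obtain ⟨t, ht⟩ := exists_smul_fibreSection hdisc y
      refine ⟨s * t⁻¹, ?_⟩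
      simp only
      rw [mul_smul, ← ht, inv_smul_smul, ← hs, hx']
  map_eq_integral f _ y := fibreAverage_eq_haarIntegral hdisc f y

end Extension

end UnifAlg

theorem mainTheorem8 (K : Set ℂ) [CompactSpace K] (hdisc : K ⊆ Metric.ball (0 : ℂ) 1)
    (hnontrivial : UnifAlg.planeR K ≠ ⊤)
    (hJensen : UnifAlg.NoNontrivialJensenMeasures (UnifAlg.planeR K)) :
    UnifAlg.IsNatural (UnifAlg.R (UnifAlg.XK K)) ∧
    ∃ _action : MulAction Circle (UnifAlg.XK K),
      (∀ (s : Circle) (v : UnifAlg.XK K),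
        ((s • v : UnifAlg.XK K) : Fin 2 → ℂ) = ![v.1 0, (s : ℂ) * v.1 1]) ∧
      ContinuousSMul Circle (UnifAlg.XK K) ∧
      ∃ T : C(UnifAlg.XK K, ℂ) →L[ℂ] C(K, ℂ),
        UnifAlg.IsImplementedBy Circle (UnifAlg.planeR K) (UnifAlg.R (UnifAlg.XK K))
          (UnifAlg.XK.proj K) T := by
  -- If K were empty, C(K) would be the zero algebra and R(K) all of it.
  have hne : Nonempty K := by
    by_contra hempty
    rw [not_nonempty_iff] at hempty
    exact hnontrivial (eq_top_iff.2 fun f _ => Subsingleton.elim 0 f ▸ zero_mem _)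
  exact ⟨UnifAlg.isNatural_R_XK hdisc hJensen, UnifAlg.rotation K, UnifAlg.coe_rotation_smul,
    UnifAlg.continuousSMul_rotation, UnifAlg.fibreAverage hdisc,
    UnifAlg.isImplementedBy_rotation hdisc⟩
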